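/- Let $(\mathcal M,V_0,V_1)$ be a compact smooth cobordism, i.e. a compact Hausdorff smooth manifold with boundary, of dimension $n\ge 1$, with $\partial\mathcal M=V_0\amalg V_1$ ($V_0$ or $V_1$ may be empty). Let $h$ be a smooth Riemannian metric on $\mathcal M$, let $\zeta>1$ be a real number, and let $f:\mathcal M\to[0,1]$ be a smooth Morse function with $f^{-1}(0)=V_0$, $f^{-1}(1)=V_1$, all of whose critical points lie in the interior of $\mathcal M$ and are nondegenerate (the Hessian is invertible). The Morse metric is $$g_{\mu\nu}=(h^{\rho\lambda}\,\partial_\rho f\,\partial_\lambda f)\,h_{\mu\nu}-\zeta\,\partial_\mu f\,\partial_\nu f .$$ The Morse spacetime is $(M,g)$, where $M$ is $\mathcal M$ with the critical points of $f$ removed, time-oriented by the timelike vector field $u^\mu=h^{\mu\nu}\partial_\nu f$: a vector $v$ is timelike if $g(v,v)<0$, and a timelike vector $v$ is future pointing if $g(v,u)<0$. The chronology $I^+\subset M\times M$ is the set of pairs $(x,y)$ for which there is a $C^1$ path $\gamma:[0,1]\to M$ with $\gamma(0)=x$, $\gamma(1)=y$, whose tangent vector is timelike and future pointing at every $t\in[0,1]$;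 $I^+(x)=\{y:(x,y)\in I^+\}$ and $I^-(x)=\{y:(y,x)\in I^+\}$. The relation $K^+\subset M\times M$ is the smallest transitive relation that contains $I^+$ and is closed in $M\times M$; $K^+(x)=\{y:(x,y)\in K^+\}$ and $K^-(x)=\{y:(y,x)\in K^+\}$. For $U\subset M$, the common future and the common past of $U$ are $$\uparrow U=\operatorname{int}\{y\in M: (u,y)\in I^+\ \ \forall u\in U\},\qquad \downarrow U=\operatorname{int}\{y\in M: (y,u)\in I^+\ \ \forall u\in U\}.$$ Suppose that $f$ has exactly one critical value (possibly attained at several critical points). Then for every point $x\in M$ that does not lie on the boundary $\partial\mathcal M=V_0\amalg V_1$, $$K^+(x)=\overline{\uparrow I^-(x)}\qquad\text{and}\qquad K^-(x)=\overline{\downarrow I^+(x)},$$ where interiors and closures are taken in $M$. -/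

import Mathlib

open Set Topology
open scoped Manifold ContDiff

noncomputable section

/-! ### The relation `K⁺` generated by a chronology, and common futures and pasts

A relation on `X` is a subset of `X × X`. -/

section Order

variable {X : Type*} [TopologicalSpace X]

/-- A relation, regarded as a subset of `X × X`, is transitive. -/
def RelTransitive (R : Set (X × X)) : Prop :=
  ∀ x y z : X, (x, y) ∈ R → (y, z) ∈ R → (x, z) ∈ R

/-- `K⁺`: the smallest transitive relation that contains the chronology `I` and is closed as a
subset of `X × X`. -/
def KRel (I : Set (X × X)) : Set (X × X) :=
  ⋂₀ {R | I ⊆ R ∧ RelTransitive R ∧ IsClosed R}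

/-- `KRel I` is indeed the least closed transitive relation that contains `I`. -/
theorem KRel_isLeast (I : Set (X × X)) :
    IsLeast {R | I ⊆ R ∧ RelTransitive R ∧ IsClosed R} (KRel I) := by
  refine ⟨⟨?_, ?_, ?_⟩, fun R hR => sInter_subset_of_mem hR⟩
  · exact subset_sInter fun R hR => hR.1
  · intro x y z hxy hyz R hR
    exact hR.2.1 x y z (hxy R hR) (hyz R hR)
  · exact isClosed_sInter fun R hR => hR.2.2

/-- The future of a point with respect to a relation. -/
def relFuture (R : Set (X × X)) (x : X) : Set X := {y | (x, y) ∈ R}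

/-- The past of a point with respect to a relation. -/
def relPast (R : Set (X × X)) (x : X) : Set X := {y | (y, x) ∈ R}

/-- The common future `↑U` of `U`: the interior of the set of all points that lie to the
chronological future of every point of `U`. -/
def commonFuture (I : Set (X × X)) (U : Set X) : Set X :=
  interior {x | ∀ u ∈ U, (u, x) ∈ I}

/-- The common past `↓U` of `U`: the interior of the set of all points that lie to the
chronological past of every point of `U`. -/
def commonPast (I : Set (X × X)) (U : Set X) : Set X :=
  interior {x | ∀ u ∈ U, (x, u) ∈ I}

end Order

/-! ### Gradients and Hessians -/

section Calculus

variable {n : ℕ} [NeZero n]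
  {N : Type*} [TopologicalSpace N] [ChartedSpace (EuclideanHalfSpace n) N]

/-- The differential of a real function at a point of a manifold with boundary. -/
def differential (f : N → ℝ) (x : N) : TangentSpace (𝓡∂ n) x →L[ℝ] ℝ :=
  mfderiv (𝓡∂ n) 𝓘(ℝ, ℝ) f x

/-- The critical points of a real function: the points where its differential vanishes. -/
def criticalSet (f : N → ℝ) : Set N := {x | differential (n := n) f x = 0}

/-- The matrix `∂_μ ∂_ν f` of second derivatives at `p`, in the coordinates of the preferred chart
at `p`. (It is used at interior points only.) -/
def coordHessian (f : N → ℝ) (p : N) : Matrix (Fin n) (Fin n) ℝ :=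
  Matrix.of fun i j =>
    fderiv ℝ (fderiv ℝ (f ∘ (extChartAt (𝓡∂ n) p).symm)) (extChartAt (𝓡∂ n) p p)
      (EuclideanSpace.single i 1) (EuclideanSpace.single j 1)

variable [IsManifold (𝓡∂ n) ∞ N]

variable (n N) in
/-- Smooth Riemannian metrics on a manifold with boundary. -/
abbrev SmoothRiemannianMetric : Type _ :=
  Bundle.ContMDiffRiemannianMetric (𝓡∂ n) ∞ (EuclideanSpace ℝ (Fin n))
    (fun x : N => TangentSpace (𝓡∂ n) x)

/-- A Riemannian metric at a point, as a bilinear form on the tangent space. -/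
def metricForm (h : SmoothRiemannianMetric n N) (x : N) :
    LinearMap.BilinForm ℝ (TangentSpace (𝓡∂ n) x) :=
  LinearMap.mk₂ ℝ (fun v w => h.inner x v w)
    (by intros; simp) (by intros; simp) (by intros; simp) (by intros; simp)

theorem metricForm_nondegenerate (h : SmoothRiemannianMetric n N) (x : N) :
    (metricForm h x).Nondegenerate := by
  constructor
  · intro v hv
    by_contra hne
    exact (h.pos x v hne).ne' (hv v)
  · intro v hv
    by_contra hne
    exact (h.pos x v hne).ne' (hv v)

instance (x : N) : FiniteDimensional ℝ (TangentSpace (𝓡∂ n) x) :=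
  inferInstanceAs (FiniteDimensional ℝ (EuclideanSpace ℝ (Fin n)))

/-- The gradient `h^{μν} ∂_ν f`. -/
def gradientVec (h : SmoothRiemannianMetric n N) (f : N → ℝ) (x : N) :
    TangentSpace (𝓡∂ n) x :=
  ((metricForm h x).toDual (metricForm_nondegenerate h x)).symm
    (differential (n := n) f x).toLinearMap

/-- The defining property of the gradient. -/
theorem inner_gradientVec (h : SmoothRiemannianMetric n N) (f : N → ℝ) (x : N)
    (v : TangentSpace (𝓡∂ n) x) :
    h.inner x (gradientVec h f x) v = differential (n := n) f x v :=
  LinearMap.BilinForm.apply_toDual_symm_apply (hB := metricForm_nondegenerate h x)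
    (differential (n := n) f x).toLinearMap v

end Calculus

/-! ### Morse geometries and Morse spacetimes -/

/-- A Morse geometry on a compact cobordism `(N, V₀, V₁)`: a Riemannian metric `h`, a Morse
function `f : N → [0, 1]` with `f⁻¹(0) = V₀` and `f⁻¹(1) = V₁` and with all its critical points in
the interior of `N`, and a real constant `ζ > 1`. -/
structure MorseGeometry (n : ℕ) [NeZero n] (N : Type*) [TopologicalSpace N] [T2Space N]
    [CompactSpace N] [ChartedSpace (EuclideanHalfSpace n) N] [IsManifold (𝓡∂ n) ∞ N] where
  /-- The initial boundary; it may be empty. -/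
  V₀ : Set N
  /-- The final boundary; it may be empty. -/
  V₁ : Set N
  boundary_eq : (𝓡∂ n).boundary N = V₀ ∪ V₁
  boundary_disjoint : Disjoint V₀ V₁
  /-- The Riemannian metric. -/
  h : SmoothRiemannianMetric n N
  /-- The Morse function. -/
  f : N → ℝ
  smooth_f : ContMDiff (𝓡∂ n) 𝓘(ℝ, ℝ) ∞ f
  f_mem : ∀ x, f x ∈ Icc (0 : ℝ) 1
  f_preimage_zero : f ⁻¹' {0} = V₀
  f_preimage_one : f ⁻¹' {1} = V₁
  critical_interior : criticalSet (n := n) f ⊆ (𝓡∂ n).interior N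
  hessian_invertible : ∀ p ∈ criticalSet (n := n) f, IsUnit (coordHessian (n := n) f p)
  /-- The constant in the Morse metric. -/
  ζ : ℝ
  one_lt_ζ : 1 < ζ

namespace MorseGeometry

variable {n : ℕ} [NeZero n] {N : Type*} [TopologicalSpace N] [T2Space N] [CompactSpace N]
  [ChartedSpace (EuclideanHalfSpace n) N] [IsManifold (𝓡∂ n) ∞ N] (G : MorseGeometry n N)

/-- The Morse metric
`g_{μν} = (h^{ρλ} ∂_ρ f ∂_λ f) h_{μν} - ζ ∂_μ f ∂_ν f`. -/
def metric (x : N) (v w : TangentSpace (𝓡∂ n) x) : ℝ :=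
  G.h.inner x (gradientVec G.h G.f x) (gradientVec G.h G.f x) * G.h.inner x v w
    - G.ζ * (differential (n := n) G.f x v * differential (n := n) G.f x w)

/-- A tangent vector is timelike for the Morse metric (of signature `(-, +, …, +)`) and future
pointing for the time orientation given by the timelike vector field `h^{μν} ∂_ν f`. -/
def IsFutureTimelike (x : N) (v : TangentSpace (𝓡∂ n) x) : Prop :=
  G.metric x v v < 0 ∧ G.metric x v (gradientVec G.h G.f x) < 0

/-- The Morse spacetime: the cobordism with the critical points of the Morse function excised,
with the subspace topology. -/
abbrev Spacetime : Type _ := {x : N // x ∉ criticalSet (n := n) G.f}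

/-- `γ`, restricted to `[0, 1]`, is a future directed timelike path in the Morse spacetime: it is
`C¹`, avoids the critical points, and has a future pointing timelike tangent vector at every
`t ∈ [0, 1]` (one-sided at the two ends). -/
structure IsFutureTimelikePath (γ : ℝ → N) : Prop where
  contMDiffOn : ContMDiffOn 𝓘(ℝ, ℝ) (𝓡∂ n) 1 γ (Icc 0 1)
  regular : ∀ t ∈ Icc (0 : ℝ) 1, γ t ∉ criticalSet (n := n) G.f
  timelike : ∀ t ∈ Icc (0 : ℝ) 1,
    G.IsFutureTimelike (γ t) (mfderivWithin 𝓘(ℝ, ℝ) (𝓡∂ n) γ (Icc 0 1) t (1 : ℝ))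

/-- The chronology relation `I⁺` of the Morse spacetime. -/
def chronology : Set (G.Spacetime × G.Spacetime) :=
  {q | ∃ γ : ℝ → N, G.IsFutureTimelikePath γ ∧ γ 0 = q.1 ∧ γ 1 = q.2}

/-- The chronological future `I⁺(x)`. -/
def IPlus (x : G.Spacetime) : Set G.Spacetime := relFuture G.chronology x

/-- The chronological past `I⁻(x)`. -/
def IMinus (x : G.Spacetime) : Set G.Spacetime := relPast G.chronology x

/-- `K⁺(x)`. -/
def KPlus (x : G.Spacetime) : Set G.Spacetime := relFuture (KRel G.chronology) x

/-- `K⁻(x)`. -/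
def KMinus (x : G.Spacetime) : Set G.Spacetime := relPast (KRel G.chronology) x

end MorseGeometry

end

/-!
# The relation `K⁺` of a Morse spacetime with one critical level

Write `x ≪ y` for the chronology. The inclusion of the closure of `↑I⁻(x)` in `K⁺(x)` is formal: if
`u ≪ y` for all `u ≪ x`, then `(x, y)` is a limit of such pairs `(u, y)`. The other inclusion rests
on the fact that the relation

  `R = {(x, y) | f x ≤ f y, and u ≪ w whenever u ≪ x and y ≪ w}`

contains `K⁺` (`IsMorseChronology.KRel_subset`). It contains the chronology, and it is closed since
chronological futures and pasts are open in the interior; the point is that `R` is transitive. If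
`(x, y), (y, z) ∈ R` and `u ≪ u₁ ≪ x`, then `(u₁, y)` lies in the closure of the chronology, and `u
≪ y` would give what is needed. So the question is whether `u ≪ u₁` and a sequence of timelike paths
from points near `u₁` to points near `y` yield `u ≪ y`. Near a regular point this is true
(`exists_nhds_chron_of_mem_chronClosure`): the room in `u ≪ u₁` can be spread over an approximating
path, since the cones vary in a Lipschitz way. Globally, one takes a limit of the approximating
paths, parametrized by the level of `f`, and moves along it in finitely many local steps, provided
that the limit curve avoids the critical points. It does if `f y ≤ c`, where `c` is the critical
value, because the curve lies below the level `f y` until it reaches `y`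
(`Chron.of_mem_chronClosure`). If `f y ≥ c`, the same argument is applied with time reversed, to `y`
and `z` in place of `x` and `y`. This is where the uniqueness of the critical value enters.

Continuity of limit curves, and antisymmetry of `K⁺`, come from functions that vary more slowly than
`f` along timelike paths and that separate points (`exists_slow_function`).

Points of the final boundary have an empty future, and `R` says nothing about them. If `y` is such a
point in `K⁺(x)`, it is a limit of points of `K⁺(x)` below it, because between two `K⁺`-related
points there is a point on every level above the critical one
(`IsMorseChronology.exists_level_of_mem_KRel`).

The statement on `K⁻` follows by reversal of time, under which the list of properties
`IsMorseChronology` is invariant.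
-/

noncomputable section

/-! ### Fields of convex cones in a normed space -/

section ConeField

variable {E : Type*} [NormedAddCommGroup E] [NormedSpace ℝ E]

/-- `Q ξ` is a superlinear functional on `E` depending on `ξ ∈ U` in a Lipschitz way, so that
`{v | 0 < Q ξ v}` is a Lipschitz field of open convex cones on `U`. The vector `V` lies in all these
cones, uniformly, and the functionals `D ξ` control the norms of the vectors in the cones. -/
structure IsConeField (Q D : E → E → ℝ) (U : Set E) (K q : ℝ) (V : E) : Prop where
  K_pos : 0 < K
  q_pos : 0 < q
  add_le : ∀ ξ ∈ U, ∀ v w, Q ξ v + Q ξ w ≤ Q ξ (v + w)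
  smul_eq : ∀ ξ ∈ U, ∀ a : ℝ, 0 ≤ a → ∀ v, Q ξ (a • v) = a * Q ξ v
  lip : ∀ ξ ∈ U, ∀ η ∈ U, ∀ v, |Q ξ v - Q η v| ≤ K * ‖ξ - η‖ * ‖v‖
  bdd : ∀ ξ ∈ U, ∀ v, |Q ξ v| ≤ K * ‖v‖
  le_V : ∀ ξ ∈ U, q ≤ Q ξ V
  norm_le : ∀ ξ ∈ U, ∀ v, 0 < Q ξ v → ‖v‖ ≤ K * D ξ v

theorem IsConeField.mono {Q D : E → E → ℝ} {U U' : Set E} {K q : ℝ} {V : E}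
    (h : IsConeField Q D U K q V) (hU : U' ⊆ U) : IsConeField Q D U' K q V where
  K_pos := h.K_pos
  q_pos := h.q_pos
  add_le ξ hξ := h.add_le ξ (hU hξ)
  smul_eq ξ hξ := h.smul_eq ξ (hU hξ)
  lip ξ hξ η hη := h.lip ξ (hU hξ) η (hU hη)
  bdd ξ hξ := h.bdd ξ (hU hξ)
  le_V ξ hξ := h.le_V ξ (hU hξ)
  norm_le ξ hξ := h.norm_le ξ (hU hξ)

theorem IsConeField.congr {Q D Q' D' : E → E → ℝ} {U : Set E} {K q : ℝ} {V : E}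
    (h : IsConeField Q D U K q V) (hQ : ∀ ξ ∈ U, Q' ξ = Q ξ) (hD : ∀ ξ ∈ U, D' ξ = D ξ) :
    IsConeField Q' D' U K q V where
  K_pos := h.K_pos
  q_pos := h.q_pos
  add_le ξ hξ := by rw [hQ ξ hξ]; exact h.add_le ξ hξ
  smul_eq ξ hξ := by rw [hQ ξ hξ]; exact h.smul_eq ξ hξ
  lip ξ hξ η hη := by rw [hQ ξ hξ, hQ η hη]; exact h.lip ξ hξ η hη
  bdd ξ hξ := by rw [hQ ξ hξ]; exact h.bdd ξ hξ
  le_V ξ hξ := by rw [hQ ξ hξ]; exact h.le_V ξ hξ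
  norm_le ξ hξ := by rw [hQ ξ hξ, hD ξ hξ]; exact h.norm_le ξ hξ

/-- Minkowski's inequality for a positive semidefinite bilinear form. -/
theorem sqrt_bilin_add_le (B : E →L[ℝ] E →L[ℝ] ℝ) (hs : ∀ v w, B v w = B w v)
    (hp : ∀ v, 0 ≤ B v v) (v w : E) :
    √(B (v + w) (v + w)) ≤ √(B v v) + √(B w w) := by
  have hcs : (B v w) ^ 2 ≤ B v v * B w w := by
    let B' : LinearMap.BilinForm ℝ E :=
      LinearMap.mk₂ ℝ (fun v w => B v w) (by intros; simp) (by intros; simp) (by intros; simp)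
        (by intros; simp)
    exact LinearMap.BilinForm.apply_sq_le_of_symm B' hp ⟨fun x y => hs x y⟩ v w
  have h1 : B v w ≤ √(B v v) * √(B w w) := by
    rw [← Real.sqrt_mul (hp v)]
    exact Real.le_sqrt_of_sq_le hcs
  apply Real.sqrt_le_iff.2 ⟨by positivity, ?_⟩
  have h2 := Real.sq_sqrt (hp v)
  have h3 := Real.sq_sqrt (hp w)
  have h4 := hs v w
  simp only [map_add, add_apply]
  nlinarith

theorem abs_sqrt_sub_sqrt_le {a b δ m : ℝ} (hm : 0 < m) (hb : 0 ≤ b)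
    (ham : m ^ 2 ≤ a) (h : |a - b| ≤ δ) : |√a - √b| ≤ δ / m := by
  have ha0 : 0 ≤ a := le_trans (by positivity) ham
  have h1 : m ≤ √a := Real.le_sqrt_of_sq_le ham
  have h2 := Real.sqrt_nonneg b
  rw [le_div_iff₀ hm]
  have h3 : |√a - √b| * (√a + √b) = |a - b| := by
    rw [← abs_of_nonneg (show 0 ≤ √a + √b by linarith), ← abs_mul]
    congr 1
    have := Real.sq_sqrt ha0
    have := Real.sq_sqrt hb
    nlinarith
  calc |√a - √b| * m ≤ |√a - √b| * (√a + √b) := by gcongr; linarith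
    _ ≤ δ := by rw [h3]; exact h

/-- A quadratic form that is positive definite at a point and continuous there is uniformly
positive definite near that point. -/
theorem eventually_bilin_lower_bound [FiniteDimensional ℝ E] {s : Set E} {ξ₀ : E}
    {B : E → E →L[ℝ] E →L[ℝ] ℝ} (hB : ∀ δ > 0, ∀ᶠ ξ in 𝓝[s] ξ₀, ‖B ξ - B ξ₀‖ < δ)
    (hpos : ∀ v, v ≠ 0 → 0 < B ξ₀ v v) :
    ∃ m : ℝ, 0 < m ∧ ∀ᶠ ξ in 𝓝[s] ξ₀, ∀ v, m ^ 2 * ‖v‖ ^ 2 ≤ B ξ v v := by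
  obtain ⟨m, hm, hmB⟩ : ∃ m : ℝ, 0 < m ∧ ∀ v ∈ Metric.sphere (0 : E) 1, m ≤ B ξ₀ v v := by
    have hc : ContinuousOn (fun v => B ξ₀ v v) (Metric.sphere (0 : E) 1) := by
      fun_prop
    rcases (Metric.sphere (0 : E) 1).eq_empty_or_nonempty with he | hne
    · exact ⟨1, one_pos, by simp [he]⟩
    · obtain ⟨v, hv, hmin⟩ := (isCompact_sphere (0 : E) 1).exists_isMinOn hne hc
      refine ⟨B ξ₀ v v, hpos v ?_, fun w hw => hmin hw⟩
      rintro rfl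
      simp at hv
  have hlow : ∀ v, m * ‖v‖ ^ 2 ≤ B ξ₀ v v := by
    intro v
    by_cases hv : v = 0
    · simp [hv]
    have hv' : 0 < ‖v‖ := norm_pos_iff.2 hv
    have := hmB (‖v‖⁻¹ • v) (by simp [norm_smul, hv'.ne'])
    simp only [map_smul, smul_apply, smul_eq_mul] at this
    calc m * ‖v‖ ^ 2 ≤ (‖v‖⁻¹ * (‖v‖⁻¹ * B ξ₀ v v)) * ‖v‖ ^ 2 := by gcongr
      _ = B ξ₀ v v := by field_simp
  refine ⟨√(m / 2), by positivity, ?_⟩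
  filter_upwards [hB (m / 2) (half_pos hm)] with ξ hξ v
  rw [Real.sq_sqrt (by positivity)]
  have h1 : |(B ξ - B ξ₀) v v| ≤ m / 2 * ‖v‖ ^ 2 := by
    rw [← Real.norm_eq_abs]
    calc ‖(B ξ - B ξ₀) v v‖ ≤ ‖B ξ - B ξ₀‖ * ‖v‖ * ‖v‖ := (B ξ - B ξ₀).le_opNorm₂ v v
      _ ≤ m / 2 * ‖v‖ * ‖v‖ := by gcongr
      _ = _ := by ring
  have h2 := hlow v
  simp only [sub_apply] at h1
  have := (abs_le.1 h1).1
  linarith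

/-- A `C¹` positive definite form and a `C¹` covector field define a Lipschitz field of cones
`{v | √(B v v) < κ β v}`. -/
theorem exists_isConeField [FiniteDimensional ℝ E] {s : Set E} (hs : Convex ℝ s) {ξ₀ : E}
    {β : E → E →L[ℝ] ℝ} {B : E → E →L[ℝ] E →L[ℝ] ℝ} (hβ : ContDiffWithinAt ℝ 1 β s ξ₀)
    (hB : ContDiffWithinAt ℝ 1 B s ξ₀) (hξ₀ : ξ₀ ∈ s)
    (hsymm : ∀ᶠ ξ in 𝓝[s] ξ₀, ∀ v w, B ξ v w = B ξ w v)
    (hpos : ∀ v, v ≠ 0 → 0 < B ξ₀ v v) {κ : ℝ} (hκ : 0 < κ) {V : E}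
    (hV : 0 < κ * β ξ₀ V - √(B ξ₀ V V)) :
    ∃ r > 0, ∃ K q, IsConeField (fun ξ v => κ * β ξ v - √(B ξ v v)) (fun ξ v => β ξ v)
      (Metric.ball ξ₀ r ∩ s) K q V := by
  -- `C¹` functions are Lipschitz near `ξ₀` within the convex set `s`, and the square root is
  -- Lipschitz away from zero; by homogeneity only unit vectors matter
  obtain ⟨K₁, t₁, ht₁, hK₁⟩ := hβ.exists_lipschitzOnWith hs
  obtain ⟨K₂, t₂, ht₂, hK₂⟩ := hB.exists_lipschitzOnWith hs
  have hBδ : ∀ δ > 0, ∀ᶠ ξ in 𝓝[s] ξ₀, ‖B ξ - B ξ₀‖ < δ := by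
    intro δ hδ
    have h1 : ∀ᶠ ξ in 𝓝[s] ξ₀, (K₂ : ℝ) * ‖ξ - ξ₀‖ < δ := by
      have h2 : Continuous fun ξ => (K₂ : ℝ) * ‖ξ - ξ₀‖ := by fun_prop
      exact (h2.tendsto' ξ₀ 0 (by simp)).eventually_lt_const hδ |>.filter_mono nhdsWithin_le_nhds
    filter_upwards [h1, ht₂] with ξ hξ hξt
    have := hK₂.dist_le_mul ξ hξt ξ₀ (mem_of_mem_nhdsWithin hξ₀ ht₂)
    rw [dist_eq_norm, dist_eq_norm] at this
    exact this.trans_lt hξ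
  obtain ⟨m, hm, hmB⟩ := eventually_bilin_lower_bound hBδ hpos
  have hβc : ∀ᶠ ξ in 𝓝[s] ξ₀, ‖β ξ‖ < ‖β ξ₀‖ + 1 :=
    hβ.continuousWithinAt.norm.eventually_lt_const (lt_add_one _)
  have hBc : ∀ᶠ ξ in 𝓝[s] ξ₀, ‖B ξ‖ < ‖B ξ₀‖ + 1 := by
    filter_upwards [hBδ 1 one_pos] with ξ hξ
    linarith [norm_sub_norm_le (B ξ) (B ξ₀)]
  set q := (κ * β ξ₀ V - √(B ξ₀ V V)) / 2 with hq
  have hVc : ∀ᶠ ξ in 𝓝[s] ξ₀, q < κ * β ξ V - √(B ξ V V) := by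
    have h1 : ContinuousWithinAt (fun ξ => κ * β ξ V - √(B ξ V V)) s ξ₀ := by
      have h2 := hβ.continuousWithinAt
      have h3 := hB.continuousWithinAt
      have h4 : ContinuousWithinAt (fun ξ => β ξ V) s ξ₀ := h2.clm_apply continuousWithinAt_const
      have h5 : ContinuousWithinAt (fun ξ => B ξ V V) s ξ₀ :=
        (h3.clm_apply continuousWithinAt_const).clm_apply continuousWithinAt_const
      exact (h4.const_mul κ).sub h5.sqrt
    refine h1.eventually_const_lt ?_
    rw [hq]; linarith
  have hall := (((((hmB.and ht₁).and ht₂).and hβc).and hBc).and hVc).and hsymm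
  obtain ⟨r, hr, hball⟩ := Metric.mem_nhdsWithin_iff.1 hall
  set K : ℝ := max (max (κ * K₁ + K₂ / m) (κ * (‖β ξ₀‖ + 1) + (√(‖B ξ₀‖ + 1)))) (κ / m) with hK
  have hKpos : 0 < K := lt_of_lt_of_le (by positivity) (le_max_right _ _)
  refine ⟨r, hr, K, q, hKpos, by rw [hq]; linarith, ?_, ?_, ?_, ?_, ?_, ?_⟩
  · intro ξ hξ v w
    obtain ⟨⟨⟨⟨⟨⟨h1, _⟩, _⟩, _⟩, _⟩, _⟩, h2⟩ := hball hξ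
    have := sqrt_bilin_add_le (B ξ) h2 (fun v => le_trans (by positivity) (h1 v)) v w
    simp only [map_add (β ξ)]
    linarith
  · intro ξ hξ a ha v
    have : B ξ (a • v) (a • v) = a ^ 2 * B ξ v v := by
      simp only [map_smul, smul_apply, smul_eq_mul]; ring
    rw [this, map_smul, smul_eq_mul, Real.sqrt_mul (by positivity), Real.sqrt_sq ha]; ring
  · intro ξ hξ η hη v
    obtain ⟨⟨⟨⟨⟨⟨h1, h3⟩, h4⟩, _⟩, _⟩, _⟩, h2⟩ := hball hξ
    obtain ⟨⟨⟨⟨⟨⟨h1', h3'⟩, h4'⟩, _⟩, _⟩, _⟩, h2'⟩ := hball hη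
    have e1 : |β ξ v - β η v| ≤ K₁ * ‖ξ - η‖ * ‖v‖ := by
      have := hK₁.dist_le_mul ξ h3 η h3'
      rw [dist_eq_norm, dist_eq_norm] at this
      calc |β ξ v - β η v| = ‖(β ξ - β η) v‖ := by simp
        _ ≤ ‖β ξ - β η‖ * ‖v‖ := (β ξ - β η).le_opNorm v
        _ ≤ _ := by gcongr
    have e2 : |√(B ξ v v) - √(B η v v)| ≤ K₂ / m * ‖ξ - η‖ * ‖v‖ := by
      by_cases hv : v = 0
      · simp [hv]
      have hv' : 0 < ‖v‖ := norm_pos_iff.2 hv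
      have := hK₂.dist_le_mul ξ h4 η h4'
      rw [dist_eq_norm, dist_eq_norm] at this
      have e3 : |B ξ v v - B η v v| ≤ K₂ * ‖ξ - η‖ * ‖v‖ ^ 2 := by
        calc |B ξ v v - B η v v| = ‖(B ξ - B η) v v‖ := by simp
          _ ≤ ‖B ξ - B η‖ * ‖v‖ * ‖v‖ := (B ξ - B η).le_opNorm₂ v v
          _ ≤ K₂ * ‖ξ - η‖ * ‖v‖ * ‖v‖ := by gcongr
          _ = _ := by ring
      have e4 := abs_sqrt_sub_sqrt_le (m := m * ‖v‖) (by positivity)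
        (le_trans (by positivity) (h1' v)) (by rw [mul_pow]; exact h1 v) e3
      refine e4.trans (le_of_eq ?_)
      field_simp
    calc |κ * β ξ v - √(B ξ v v) - (κ * β η v - √(B η v v))|
        = |κ * (β ξ v - β η v) - (√(B ξ v v) - √(B η v v))| := by congr 1; ring
      _ ≤ |κ * (β ξ v - β η v)| + |√(B ξ v v) - √(B η v v)| := abs_sub _ _
      _ ≤ κ * (K₁ * ‖ξ - η‖ * ‖v‖) + K₂ / m * ‖ξ - η‖ * ‖v‖ := by
          rw [abs_mul, abs_of_pos hκ]; gcongr
      _ = (κ * K₁ + K₂ / m) * (‖ξ - η‖ * ‖v‖) := by ring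
      _ ≤ K * (‖ξ - η‖ * ‖v‖) := by
          gcongr; exact (le_max_left _ _).trans (le_max_left _ _)
      _ = _ := by ring
  · intro ξ hξ v
    obtain ⟨⟨⟨⟨⟨⟨h1, h3⟩, h4⟩, h5⟩, h6⟩, _⟩, h2⟩ := hball hξ
    have e1 : |β ξ v| ≤ (‖β ξ₀‖ + 1) * ‖v‖ :=
      ((β ξ).le_opNorm v).trans (by gcongr)
    have e2 : √(B ξ v v) ≤ √(‖B ξ₀‖ + 1) * ‖v‖ := by
      rw [← Real.sqrt_sq (norm_nonneg v), ← Real.sqrt_mul (by positivity)]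
      apply Real.sqrt_le_sqrt
      calc B ξ v v ≤ ‖B ξ v v‖ := Real.le_norm_self _
        _ ≤ ‖B ξ‖ * ‖v‖ * ‖v‖ := (B ξ).le_opNorm₂ v v
        _ ≤ (‖B ξ₀‖ + 1) * ‖v‖ * ‖v‖ := by gcongr
        _ = _ := by ring
    calc |κ * β ξ v - √(B ξ v v)| ≤ |κ * β ξ v| + |√(B ξ v v)| := abs_sub _ _
      _ ≤ κ * ((‖β ξ₀‖ + 1) * ‖v‖) + √(‖B ξ₀‖ + 1) * ‖v‖ := by
          rw [abs_mul, abs_of_pos hκ, abs_of_nonneg (Real.sqrt_nonneg (B ξ v v))]; gcongr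
      _ = (κ * (‖β ξ₀‖ + 1) + √(‖B ξ₀‖ + 1)) * ‖v‖ := by ring
      _ ≤ K * ‖v‖ := by
          gcongr; exact (le_max_right _ _).trans (le_max_left _ _)
  · intro ξ hξ
    exact (hball hξ).1.2.le
  · intro ξ hξ v hv
    obtain ⟨⟨⟨⟨⟨⟨h1, h3⟩, h4⟩, h5⟩, h6⟩, _⟩, h2⟩ := hball hξ
    have e1 : m * ‖v‖ ≤ √(B ξ v v) := by
      apply Real.le_sqrt_of_sq_le
      rw [mul_pow]; exact h1 v
    have e2 : 0 ≤ β ξ v := by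
      have : 0 ≤ κ * β ξ v := by
        have := Real.sqrt_nonneg (B ξ v v)
        linarith
      exact (mul_nonneg_iff_of_pos_left hκ).1 this
    calc ‖v‖ ≤ κ / m * β ξ v := by
          rw [div_mul_eq_mul_div, le_div_iff₀ hm]; linarith
      _ ≤ K * β ξ v := by gcongr; exact le_max_right _ _

end ConeField

/-! ### The cones of the Morse metric -/

namespace MorseGeometry
variable {n : ℕ} [NeZero n] {N : Type*} [TopologicalSpace N] [T2Space N] [CompactSpace N]
  [ChartedSpace (EuclideanHalfSpace n) N] [IsManifold (𝓡∂ n) ∞ N] (G : MorseGeometry n N)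

/-- A superlinear functional on the tangent space at `x` that is positive exactly at the future
pointing timelike vectors, if `x` is a regular point. -/
def coneFn (x : N) (v : TangentSpace (𝓡∂ n) x) : ℝ :=
  √G.ζ * differential (n := n) G.f x v -
    √(G.h.inner x (gradientVec G.h G.f x) (gradientVec G.h G.f x) * G.h.inner x v v)

lemma inner_nonneg (x : N) (v : TangentSpace (𝓡∂ n) x) : 0 ≤ G.h.inner x v v := by
  by_cases hv : v = 0
  · simp [hv]
  · exact (G.h.pos x v hv).le

lemma gradient_ne_zero {x : N} (hx : x ∉ criticalSet (n := n) G.f) :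
    gradientVec G.h G.f x ≠ 0 := by
  intro h0
  apply hx
  ext v
  have := inner_gradientVec G.h G.f x v
  rw [h0] at this
  simpa using this.symm

lemma isFutureTimelike_iff {x : N} (hx : x ∉ criticalSet (n := n) G.f)
    (v : TangentSpace (𝓡∂ n) x) : G.IsFutureTimelike x v ↔ 0 < G.coneFn x v := by
  have ha : 0 < G.h.inner x (gradientVec G.h G.f x) (gradientVec G.h G.f x) :=
    G.h.pos x _ (G.gradient_ne_zero hx)
  have hz := G.one_lt_ζ
  have hv := G.inner_nonneg x v
  have h1 : G.h.inner x v (gradientVec G.h G.f x) = differential (n := n) G.f x v := by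
    rw [G.h.symm, inner_gradientVec]
  have h2 := inner_gradientVec G.h G.f x (gradientVec G.h G.f x)
  unfold IsFutureTimelike metric coneFn
  rw [h1, ← h2]
  set a := G.h.inner x (gradientVec G.h G.f x) (gradientVec G.h G.f x)
  set d := differential (n := n) G.f x v
  set b := G.h.inner x v v
  have hs : √G.ζ ^ 2 = G.ζ := Real.sq_sqrt (by linarith)
  have hs0 : 0 < √G.ζ := Real.sqrt_pos.2 (by linarith)
  constructor
  · rintro ⟨h3, h4⟩
    have hd : 0 < d := by
      by_contra hd
      push Not at hd
      nlinarith [mul_nonneg (mul_nonneg ha.le (sub_nonneg.2 hz.le)) (neg_nonneg.2 hd)]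
    rw [sub_pos, Real.sqrt_lt' (by positivity), mul_pow, hs]
    nlinarith
  · intro h3
    have h4 : √(a * b) < √G.ζ * d := by linarith
    have hd : 0 < √G.ζ * d := (Real.sqrt_nonneg _).trans_lt h4
    have hd' : 0 < d := (pos_iff_pos_of_mul_pos hd).1 hs0
    rw [Real.sqrt_lt' hd, mul_pow, hs] at h4
    exact ⟨by nlinarith, by nlinarith [mul_pos (mul_pos ha hd') (sub_pos.2 hz)]⟩

lemma differential_pos_of_coneFn_pos {x : N} {v : TangentSpace (𝓡∂ n) x}
    (h : 0 < G.coneFn x v) : 0 < differential (n := n) G.f x v := by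
  have h1 : 0 < √G.ζ * differential (n := n) G.f x v := by
    have := Real.sqrt_nonneg (G.h.inner x (gradientVec G.h G.f x) (gradientVec G.h G.f x) *
      G.h.inner x v v)
    unfold coneFn at h
    linarith
  exact (pos_iff_pos_of_mul_pos h1).1 (Real.sqrt_pos.2 (by linarith [G.one_lt_ζ]))

lemma regular_of_coneFn_pos {x : N} {v : TangentSpace (𝓡∂ n) x}
    (h : 0 < G.coneFn x v) : x ∉ criticalSet (n := n) G.f := by
  intro hx
  have := G.differential_pos_of_coneFn_pos h
  rw [show differential (n := n) G.f x = 0 from hx] at this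
  simp at this

end MorseGeometry

/-! ### The cone field in a chart -/

section Chart

open Bundle

variable {n : ℕ} [NeZero n] {N : Type*} [TopologicalSpace N]
  [ChartedSpace (EuclideanHalfSpace n) N] [IsManifold (𝓡∂ n) ∞ N]

local notation "𝔼" => EuclideanSpace ℝ (Fin n)

/-- The derivative of the inverse of the preferred chart at `p`. -/
def chartFrame (p : N) (ξ : 𝔼) : 𝔼 →L[ℝ] TangentSpace (𝓡∂ n) ((extChartAt (𝓡∂ n) p).symm ξ) :=
  mfderivWithin 𝓘(ℝ, 𝔼) (𝓡∂ n) (extChartAt (𝓡∂ n) p).symm (range (𝓡∂ n)) ξ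

/-- The Riemannian metric, in coordinates. -/
def chartMetric (h : SmoothRiemannianMetric n N) (p : N) (ξ : 𝔼) : 𝔼 →L[ℝ] 𝔼 →L[ℝ] ℝ :=
  (ContinuousLinearMap.precomp ℝ (chartFrame p ξ)).comp
    ((h.inner ((extChartAt (𝓡∂ n) p).symm ξ)).comp (chartFrame p ξ))

theorem chartMetric_apply (h : SmoothRiemannianMetric n N) (p : N) (ξ v w : 𝔼) :
    chartMetric h p ξ v w =
      h.inner ((extChartAt (𝓡∂ n) p).symm ξ) (chartFrame p ξ v) (chartFrame p ξ w) := rfl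

/-- The differential of a function, in coordinates. -/
def chartDifferential (f : N → ℝ) (p : N) (ξ : 𝔼) : 𝔼 →L[ℝ] ℝ :=
  (differential (n := n) f ((extChartAt (𝓡∂ n) p).symm ξ)).comp (chartFrame p ξ)

/-- On the domain of the chart, `chartFrame` is the local frame of the tangent bundle given by the
preferred trivialization; this is how it is seen to be smooth. -/
theorem chartFrame_eq_symmL (p : N) {ξ : 𝔼} (hξ : ξ ∈ (extChartAt (𝓡∂ n) p).target) :
    chartFrame p ξ = (trivializationAt 𝔼 (TangentSpace (𝓡∂ n)) p).symmL ℝ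
      ((extChartAt (𝓡∂ n) p).symm ξ) := by
  have h1 : (extChartAt (𝓡∂ n) p).symm ξ ∈ (chartAt (EuclideanHalfSpace n) p).source := by
    rw [← extChartAt_source (𝓡∂ n)]; exact (extChartAt (𝓡∂ n) p).map_target hξ
  rw [TangentBundle.symmL_trivializationAt h1, chartFrame, (extChartAt (𝓡∂ n) p).right_inv hξ]

theorem chartFrame_bijective (p : N) {ξ : 𝔼} (hξ : ξ ∈ (extChartAt (𝓡∂ n) p).target) :
    Function.Bijective (chartFrame p ξ) := by
  have h1 : (extChartAt (𝓡∂ n) p).symm ξ ∈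
      (trivializationAt 𝔼 (TangentSpace (𝓡∂ n)) p).baseSet := by
    simpa using (extChartAt (𝓡∂ n) p).map_target hξ
  rw [chartFrame_eq_symmL p hξ, ← Trivialization.symm_continuousLinearEquivAt_eq _ h1]
  exact ((trivializationAt 𝔼 (TangentSpace (𝓡∂ n)) p).continuousLinearEquivAt ℝ _ h1).symm.bijective

theorem contMDiffAt_symmL_apply (p : N) (v : 𝔼) {x : N}
    (hx : x ∈ (extChartAt (𝓡∂ n) p).source) :
    ContMDiffAt (𝓡∂ n) ((𝓡∂ n).prod 𝓘(ℝ, 𝔼)) ∞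
      (fun x ↦ (⟨x, (trivializationAt 𝔼 (TangentSpace (𝓡∂ n)) p).symmL ℝ x v⟩ :
        TotalSpace 𝔼 (TangentSpace (𝓡∂ n) : N → Type _))) x := by
  have hx' : x ∈ (trivializationAt 𝔼 (TangentSpace (𝓡∂ n)) p).baseSet := by simpa using hx
  rw [(trivializationAt 𝔼 (TangentSpace (𝓡∂ n)) p).contMDiffAt_section_iff (IB := 𝓡∂ n) hx']
  refine (contMDiffAt_const (c := v)).congr_of_eventuallyEq ?_
  filter_upwards [(trivializationAt 𝔼 (TangentSpace (𝓡∂ n)) p).open_baseSet.mem_nhds hx'] with y hy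
  rw [Trivialization.symmL_apply _ hy]
  exact congrArg Prod.snd ((trivializationAt 𝔼 (TangentSpace (𝓡∂ n)) p).apply_mk_symm hy v)

theorem contDiffOn_chartMetric (h : SmoothRiemannianMetric n N) (p : N) :
    ContDiffOn ℝ ∞ (chartMetric h p) (extChartAt (𝓡∂ n) p).target := by
  rw [contDiffOn_clm_apply]
  intro v
  rw [contDiffOn_clm_apply]
  intro w
  have h1 : ContMDiffOn (𝓡∂ n) 𝓘(ℝ, ℝ) ∞ (fun x => h.inner x
      ((trivializationAt 𝔼 (TangentSpace (𝓡∂ n)) p).symmL ℝ x v)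
      ((trivializationAt 𝔼 (TangentSpace (𝓡∂ n)) p).symmL ℝ x w))
      (extChartAt (𝓡∂ n) p).source := by
    intro x hx
    have h2 := ContMDiffAt.clm_bundle_apply₂ (F₁ := 𝔼) (F₂ := 𝔼) (F₃ := ℝ)
      (E₃ := fun _ : N => ℝ)
      (h.contMDiff x) (contMDiffAt_symmL_apply p v hx) (contMDiffAt_symmL_apply p w hx)
    rw [Bundle.contMDiffAt_section] at h2
    exact h2.contMDiffWithinAt
  have h3 := h1.comp (contMDiffOn_extChartAt_symm (n := ∞) p) (fun ξ hξ =>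
    (extChartAt (𝓡∂ n) p).map_target hξ)
  rw [contMDiffOn_iff_contDiffOn] at h3
  refine h3.congr fun ξ hξ => ?_
  rw [chartMetric_apply, chartFrame_eq_symmL p hξ]
  rfl

theorem hasMFDerivWithinAt_extChartAt_symm (p : N) {ξ : 𝔼}
    (hξ : ξ ∈ (extChartAt (𝓡∂ n) p).target) :
    HasMFDerivWithinAt 𝓘(ℝ, 𝔼) (𝓡∂ n) (extChartAt (𝓡∂ n) p).symm (range (𝓡∂ n)) ξ
      (chartFrame p ξ) :=
  (mdifferentiableWithinAt_extChartAt_symm hξ).hasMFDerivWithinAt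

theorem hasMFDerivWithinAt_extChartAt_symm_comp {p : N} {c : ℝ → 𝔼} {s : Set ℝ} {t : ℝ}
    {c' : ℝ →L[ℝ] 𝔼}
    (hc : HasMFDerivWithinAt 𝓘(ℝ, ℝ) 𝓘(ℝ, 𝔼) c s t c')
    (hmem : c t ∈ (extChartAt (𝓡∂ n) p).target)
    (hmem' : ∀ᶠ t' in 𝓝[s] t, c t' ∈ (extChartAt (𝓡∂ n) p).target) :
    HasMFDerivWithinAt 𝓘(ℝ, ℝ) (𝓡∂ n) ((extChartAt (𝓡∂ n) p).symm ∘ c) s t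
      ((chartFrame p (c t)).comp c') := by
  have h1 := (hasMFDerivWithinAt_extChartAt_symm p hmem).comp t
    (hc.mono (inter_subset_left (t := c ⁻¹' (extChartAt (𝓡∂ n) p).target)))
    (fun x hx => extChartAt_target_subset_range p hx.2)
  exact h1.mono_of_mem_nhdsWithin (Filter.inter_mem self_mem_nhdsWithin hmem')

theorem hasFDerivWithinAt_comp_extChartAt_symm {f : N → ℝ} (p : N) {ξ : 𝔼}
    (hξ : ξ ∈ (extChartAt (𝓡∂ n) p).target)
    (hf : MDifferentiableAt (𝓡∂ n) 𝓘(ℝ, ℝ) f ((extChartAt (𝓡∂ n) p).symm ξ)) :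
    HasFDerivWithinAt (f ∘ (extChartAt (𝓡∂ n) p).symm) (chartDifferential f p ξ)
      (range (𝓡∂ n)) ξ := by
  have := hf.hasMFDerivAt.comp_hasMFDerivWithinAt ξ (hasMFDerivWithinAt_extChartAt_symm p hξ)
  exact this.hasFDerivWithinAt

theorem contDiffOn_chartDifferential {f : N → ℝ} (hf : ContMDiff (𝓡∂ n) 𝓘(ℝ, ℝ) ∞ f) (p : N) :
    ContDiffOn ℝ ∞ (chartDifferential (n := n) f p) (extChartAt (𝓡∂ n) p).target := by
  have h1 : ContDiffOn ℝ ∞ (f ∘ (extChartAt (𝓡∂ n) p).symm) (extChartAt (𝓡∂ n) p).target :=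
    contMDiffOn_iff_contDiffOn.1 (hf.comp_contMDiffOn (contMDiffOn_extChartAt_symm (n := ∞) p))
  have hu : UniqueDiffOn ℝ (extChartAt (𝓡∂ n) p).target := uniqueDiffOn_extChartAt_target p
  refine (h1.fderivWithin hu le_rfl).congr fun ξ hξ => ?_
  exact (((hasFDerivWithinAt_comp_extChartAt_symm p hξ
    (hf.mdifferentiable (by simp) _)).mono (extChartAt_target_subset_range p)).fderivWithin
      (hu ξ hξ)).symm

theorem chartMetric_pos (h : SmoothRiemannianMetric n N) (p : N) {ξ : 𝔼}
    (hξ : ξ ∈ (extChartAt (𝓡∂ n) p).target) {v : 𝔼} (hv : v ≠ 0) : 0 < chartMetric h p ξ v v := by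
  rw [chartMetric_apply]
  refine h.pos _ _ fun h0 => hv ((chartFrame_bijective p hξ).1 ?_)
  rw [h0, map_zero]

theorem chartMetric_isInvertible (h : SmoothRiemannianMetric n N) (p : N) {ξ : 𝔼}
    (hξ : ξ ∈ (extChartAt (𝓡∂ n) p).target) : (chartMetric h p ξ).IsInvertible := by
  have hinj : Function.Injective (chartMetric h p ξ).toLinearMap := by
    rw [← LinearMap.ker_eq_bot, LinearMap.ker_eq_bot']
    intro v hv
    by_contra hne
    have h1 : chartMetric h p ξ v v = 0 := by
      have : chartMetric h p ξ v = 0 := hv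
      rw [this]; rfl
    exact (chartMetric_pos h p hξ hne).ne' h1
  have hdim : Module.finrank ℝ 𝔼 = Module.finrank ℝ (𝔼 →L[ℝ] ℝ) := by
    rw [← (LinearMap.toContinuousLinearMap (𝕜 := ℝ) (E := 𝔼) (F' := ℝ)).finrank_eq]
    exact Subspace.dual_finrank_eq.symm
  refine ⟨(LinearEquiv.ofInjectiveOfFinrankEq _ hinj hdim).toContinuousLinearEquiv, ?_⟩
  ext v w
  rfl

/-- The squared norm of the gradient is smooth in coordinates. -/
theorem contDiffOn_gradient_sq (h : SmoothRiemannianMetric n N) {f : N → ℝ}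
    (hf : ContMDiff (𝓡∂ n) 𝓘(ℝ, ℝ) ∞ f) (p : N) :
    ContDiffOn ℝ ∞ (fun ξ => h.inner ((extChartAt (𝓡∂ n) p).symm ξ) (gradientVec h f _)
      (gradientVec h f _)) (extChartAt (𝓡∂ n) p).target := by
  have h1 : ContDiffOn ℝ ∞ (fun ξ => chartDifferential (n := n) f p ξ
      ((chartMetric h p ξ).inverse (chartDifferential (n := n) f p ξ)))
      (extChartAt (𝓡∂ n) p).target := by
    have hβ := contDiffOn_chartDifferential hf p
    refine hβ.clm_apply (ContDiffOn.clm_apply ?_ hβ)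
    intro ξ hξ
    exact ((chartMetric_isInvertible h p hξ).contDiffAt_map_inverse).comp_contDiffWithinAt ξ
      (contDiffOn_chartMetric h p ξ hξ)
  refine h1.congr fun ξ hξ => ?_
  obtain ⟨w, hw⟩ := (chartFrame_bijective p hξ).2 (gradientVec h f _)
  have h2 : chartMetric h p ξ w = chartDifferential (n := n) f p ξ := by
    ext v
    rw [chartMetric_apply, hw, inner_gradientVec]
    rfl
  have h3 : (chartMetric h p ξ).inverse (chartDifferential (n := n) f p ξ) = w := by
    rw [← h2, ← ContinuousLinearMap.comp_apply, (chartMetric_isInvertible h p hξ).inverse_comp_self]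
    rfl
  rw [h3, ← h2, chartMetric_apply, hw]

end Chart

namespace MorseGeometry
variable {n : ℕ} [NeZero n] {N : Type*} [TopologicalSpace N] [T2Space N] [CompactSpace N]
  [ChartedSpace (EuclideanHalfSpace n) N] [IsManifold (𝓡∂ n) ∞ N] (G : MorseGeometry n N)

local notation "𝔼" => EuclideanSpace ℝ (Fin n)

/-- The cone functional, in coordinates. -/
def chartCone (p : N) (ξ v : 𝔼) : ℝ := G.coneFn ((extChartAt (𝓡∂ n) p).symm ξ) (chartFrame p ξ v)

/-- Near a regular point, boundary points included, the future timelike vectors form a Lipschitz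
field of cones in coordinates. -/
theorem exists_isConeField_chartCone {p : N} (hp : p ∉ criticalSet (n := n) G.f) :
    ∃ r > 0, ∃ K q V, IsConeField (G.chartCone p) (fun ξ v => chartDifferential G.f p ξ v)
      (Metric.ball (extChartAt (𝓡∂ n) p p) r ∩ range (𝓡∂ n)) K q V ∧
      Metric.ball (extChartAt (𝓡∂ n) p p) r ∩ range (𝓡∂ n) ⊆ (extChartAt (𝓡∂ n) p).target := by
  set φ := extChartAt (𝓡∂ n) p with hφ
  have hp0 : φ p ∈ φ.target := mem_extChartAt_target p
  have hmem : φ.target ∈ 𝓝[range (𝓡∂ n)] (φ p) := extChartAt_target_mem_nhdsWithin p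
  set a : 𝔼 → ℝ := fun ξ => G.h.inner (φ.symm ξ) (gradientVec G.h G.f _) (gradientVec G.h G.f _)
    with ha
  have ha0 : 0 < a (φ p) := by
    refine G.h.pos _ _ (G.gradient_ne_zero ?_)
    rwa [hφ, extChartAt_to_inv]
  have hβ : ContDiffWithinAt ℝ 1 (chartDifferential (n := n) G.f p) (range (𝓡∂ n)) (φ p) :=
    ((contDiffOn_chartDifferential G.smooth_f p (φ p) hp0).of_le (by simp)).mono_of_mem_nhdsWithin
      hmem
  have hB : ContDiffWithinAt ℝ 1 (fun ξ => a ξ • chartMetric G.h p ξ) (range (𝓡∂ n)) (φ p) := by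
    have h1 : ContDiffOn ℝ ∞ (fun ξ => a ξ • chartMetric G.h p ξ) φ.target := by
      rw [contDiffOn_clm_apply]
      intro v
      rw [contDiffOn_clm_apply]
      intro w
      exact (contDiffOn_gradient_sq G.h G.smooth_f p).mul
        (((contDiffOn_chartMetric G.h p).clm_apply contDiffOn_const).clm_apply contDiffOn_const)
    exact ((h1 (φ p) hp0).of_le (by simp)).mono_of_mem_nhdsWithin hmem
  obtain ⟨V, hV⟩ := (chartFrame_bijective p hp0).2 (gradientVec G.h G.f _)
  have hz := G.one_lt_ζ
  -- the gradient lies in the cone because `ζ > 1`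
  obtain ⟨r, hr, K, q, hcone⟩ := exists_isConeField (𝓡∂ n).convex_range hβ hB
    (extChartAt_target_subset_range p hp0) (by
      refine Filter.Eventually.of_forall fun ξ v w => ?_
      simp only [smul_apply, chartMetric_apply]
      rw [G.h.symm]) (by
      intro v hv
      exact smul_pos ha0 (chartMetric_pos G.h p hp0 hv)) (κ := √G.ζ) (by positivity) (V := V) (by
      have e1 : chartDifferential G.f p (φ p) V = a (φ p) := by
        rw [ha]
        simp only [inner_gradientVec]
        rw [← hV]; rfl
      have e2 : (a (φ p) • chartMetric G.h p (φ p)) V V = a (φ p) ^ 2 := by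
        simp only [smul_apply, chartMetric_apply, hV]
        rw [sq]; rfl
      rw [e1, e2, Real.sqrt_sq ha0.le]
      have : 1 < √G.ζ := by rw [Real.lt_sqrt] <;> linarith
      nlinarith)
  obtain ⟨r', hr', hball⟩ := Metric.mem_nhdsWithin_iff.1 hmem
  refine ⟨min r r', lt_min hr hr', K, q, V, ?_, ?_⟩
  · refine (hcone.mono (inter_subset_inter_left _ (Metric.ball_subset_ball
      (min_le_left _ _)))).congr (fun ξ hξ => ?_) (fun _ _ => rfl)
    rfl
  · exact (inter_subset_inter_left _ (Metric.ball_subset_ball (min_le_right _ _))).trans hball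

end MorseGeometry

/-! ### Timelike paths -/

namespace MorseGeometry
variable {n : ℕ} [NeZero n] {N : Type*} [TopologicalSpace N] [T2Space N] [CompactSpace N]
  [ChartedSpace (EuclideanHalfSpace n) N] [IsManifold (𝓡∂ n) ∞ N] (G : MorseGeometry n N)

local notation "𝔼" => EuclideanSpace ℝ (Fin n)

/-- The path `γ` is `C¹` within `s` at `t`, with a future pointing timelike velocity. -/
def ConeAt (γ : ℝ → N) (s : Set ℝ) (t : ℝ) : Prop :=
  ContMDiffWithinAt 𝓘(ℝ, ℝ) (𝓡∂ n) 1 γ s t ∧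
    0 < G.coneFn (γ t) (mfderivWithin 𝓘(ℝ, ℝ) (𝓡∂ n) γ s t (1 : ℝ))

variable {G} {γ γ' : ℝ → N} {s s' : Set ℝ} {t : ℝ}

theorem coneFn_smul {x : N} {a : ℝ} (ha : 0 ≤ a) (v : TangentSpace (𝓡∂ n) x) :
    G.coneFn x (a • v) = a * G.coneFn x v := by
  unfold coneFn
  simp only [map_smul, smul_apply, smul_eq_mul]
  rw [show ∀ b c : ℝ, b * (a * (a * c)) = a ^ 2 * (b * c) by intros; ring,
    Real.sqrt_mul (by positivity), Real.sqrt_sq ha]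
  ring

theorem coneFn_congr (G : MorseGeometry n N) {x y : N} (h : x = y) {v : TangentSpace (𝓡∂ n) x}
    {w : TangentSpace (𝓡∂ n) y} (hvw : (show 𝔼 from v) = (show 𝔼 from w)) :
    G.coneFn x v = G.coneFn y w := by
  subst h
  exact congrArg (G.coneFn x) hvw

theorem coneAt_of_hasMFDerivWithinAt (hu : UniqueDiffWithinAt ℝ s t)
    (hγ : ContMDiffWithinAt 𝓘(ℝ, ℝ) (𝓡∂ n) 1 γ s t)
    {A : ℝ →L[ℝ] TangentSpace (𝓡∂ n) (γ t)}
    (hA : HasMFDerivWithinAt 𝓘(ℝ, ℝ) (𝓡∂ n) γ s t A) (h : 0 < G.coneFn (γ t) (A 1)) :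
    G.ConeAt γ s t := by
  refine ⟨hγ, ?_⟩
  rw [hA.mfderivWithin (uniqueMDiffWithinAt_iff_uniqueDiffWithinAt.2 hu)]
  exact h

theorem ConeAt.hasMFDerivWithinAt (h : G.ConeAt γ s t) :
    HasMFDerivWithinAt 𝓘(ℝ, ℝ) (𝓡∂ n) γ s t (mfderivWithin 𝓘(ℝ, ℝ) (𝓡∂ n) γ s t) :=
  (h.1.mdifferentiableWithinAt one_ne_zero).hasMFDerivWithinAt

theorem ConeAt.mono_of_mem (h : G.ConeAt γ s t) (hs : s ∈ 𝓝[s'] t)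
    (hu : UniqueDiffWithinAt ℝ s' t) : G.ConeAt γ s' t :=
  coneAt_of_hasMFDerivWithinAt hu (h.1.mono_of_mem_nhdsWithin hs)
    (h.hasMFDerivWithinAt.mono_of_mem_nhdsWithin hs) h.2

theorem ConeAt.congr (h : G.ConeAt γ s t) (hγ : γ' =ᶠ[𝓝[s] t] γ) (ht : γ' t = γ t) :
    G.ConeAt γ' s t := by
  refine ⟨h.1.congr_of_eventuallyEq hγ ht, ?_⟩
  have h1 := hγ.mfderivWithin_eq (I := 𝓘(ℝ, ℝ)) (I' := 𝓡∂ n) ht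
  exact h.2.trans_eq (coneFn_congr G ht (congrArg (fun A : ℝ →L[ℝ] 𝔼 => A 1) h1)).symm

/-- A curve in a chart that is timelike in coordinates is timelike. -/
theorem coneAt_of_chart {p : N} {c : ℝ → 𝔼} (hu : UniqueDiffWithinAt ℝ s t)
    (hc : ContDiffWithinAt ℝ 1 c s t)
    (hmem : c t ∈ (extChartAt (𝓡∂ n) p).target)
    (hmem' : ∀ᶠ t' in 𝓝[s] t, c t' ∈ (extChartAt (𝓡∂ n) p).target)
    (h : 0 < G.chartCone p (c t) (derivWithin c s t)) :
    G.ConeAt ((extChartAt (𝓡∂ n) p).symm ∘ c) s t := by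
  have hcd : HasMFDerivWithinAt 𝓘(ℝ, ℝ) 𝓘(ℝ, 𝔼) c s t (fderivWithin ℝ c s t) :=
    (hc.differentiableWithinAt one_ne_zero).hasFDerivWithinAt.hasMFDerivWithinAt
  have h1 : c ⁻¹' (extChartAt (𝓡∂ n) p).target ∈ 𝓝[s] t := hmem'
  have h2 := hasMFDerivWithinAt_extChartAt_symm_comp hcd hmem hmem'
  refine coneAt_of_hasMFDerivWithinAt hu ?_ h2 ?_
  · exact (ContMDiffWithinAt.comp t (contMDiffOn_extChartAt_symm (n := 1) p _ hmem)
      (hc.contMDiffWithinAt.mono (inter_subset_left (t := c ⁻¹' (extChartAt (𝓡∂ n) p).target)))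
      inter_subset_right).mono_of_mem_nhdsWithin (Filter.inter_mem self_mem_nhdsWithin h1)
  · rw [← fderivWithin_derivWithin] at h
    exact h

/-- A timelike path is timelike in coordinates. -/
theorem ConeAt.chart (h : G.ConeAt γ s t) (hu : UniqueDiffWithinAt ℝ s t) {p : N}
    (hp : γ t ∈ (extChartAt (𝓡∂ n) p).source) :
    ContDiffWithinAt ℝ 1 (extChartAt (𝓡∂ n) p ∘ γ) s t ∧
      0 < G.chartCone p (extChartAt (𝓡∂ n) p (γ t))
        (derivWithin (extChartAt (𝓡∂ n) p ∘ γ) s t) := by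
  set φ := extChartAt (𝓡∂ n) p with hφ
  have hp' : γ t ∈ (chartAt (EuclideanHalfSpace n) p).source := by rwa [← extChartAt_source (𝓡∂ n)]
  have hc : ContMDiffWithinAt 𝓘(ℝ, ℝ) 𝓘(ℝ, 𝔼) 1 (φ ∘ γ) s t :=
    (contMDiffAt_extChartAt' (n := 1) hp').comp_contMDiffWithinAt t h.1
  have hc' : ContDiffWithinAt ℝ 1 (φ ∘ γ) s t := contMDiffWithinAt_iff_contDiffWithinAt.1 hc
  refine ⟨hc', ?_⟩
  have hsrc : ∀ᶠ t' in 𝓝[s] t, γ t' ∈ φ.source :=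
    h.1.continuousWithinAt.eventually ((isOpen_extChartAt_source p).mem_nhds hp)
  have heq : γ =ᶠ[𝓝[s] t] φ.symm ∘ (φ ∘ γ) := by
    filter_upwards [hsrc] with t' ht'
    exact (φ.left_inv ht').symm
  have hcd : HasMFDerivWithinAt 𝓘(ℝ, ℝ) 𝓘(ℝ, 𝔼) (φ ∘ γ) s t (fderivWithin ℝ (φ ∘ γ) s t) :=
    (hc'.differentiableWithinAt one_ne_zero).hasFDerivWithinAt.hasMFDerivWithinAt
  have h1 : (φ ∘ γ) ⁻¹' φ.target ∈ 𝓝[s] t := by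
    filter_upwards [hsrc] with t' ht'
    exact φ.map_source ht'
  have h2 := hasMFDerivWithinAt_extChartAt_symm_comp hcd (φ.map_source hp) h1
  have h3 := h2.mfderivWithin (uniqueMDiffWithinAt_iff_uniqueDiffWithinAt.2 hu)
  have h4 : G.ConeAt (φ.symm ∘ (φ ∘ γ)) s t := h.congr heq.symm (φ.left_inv hp)
  have h5 := h4.2
  rw [h3] at h5
  rw [← fderivWithin_derivWithin]
  exact h5

theorem ConeAt.hasDerivWithinAt_comp (h : G.ConeAt γ s t) :
    HasDerivWithinAt (G.f ∘ γ)
      (differential (n := n) G.f (γ t) (mfderivWithin 𝓘(ℝ, ℝ) (𝓡∂ n) γ s t (1 : ℝ))) s t := by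
  have h1 := (G.smooth_f.mdifferentiable (by simp) (γ t)).hasMFDerivAt.comp_hasMFDerivWithinAt t
    h.hasMFDerivWithinAt
  have h2 : HasFDerivWithinAt (G.f ∘ γ) ((differential (n := n) G.f (γ t)).comp
    (mfderivWithin 𝓘(ℝ, ℝ) (𝓡∂ n) γ s t) : ℝ →L[ℝ] ℝ) s t := h1.hasFDerivWithinAt
  exact h2.hasDerivWithinAt

theorem ConeAt.hasDerivWithinAt_chart (h : G.ConeAt γ s t) (hu : UniqueDiffWithinAt ℝ s t)
    {p : N} (hp : γ t ∈ (extChartAt (𝓡∂ n) p).source) :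
    HasDerivWithinAt (G.f ∘ γ) (chartDifferential G.f p (extChartAt (𝓡∂ n) p (γ t))
      (derivWithin (extChartAt (𝓡∂ n) p ∘ γ) s t)) s t := by
  set φ := extChartAt (𝓡∂ n) p with hφ
  have hc := (h.chart hu hp).1
  have hsrc : ∀ᶠ t' in 𝓝[s] t, γ t' ∈ φ.source :=
    h.1.continuousWithinAt.eventually ((isOpen_extChartAt_source p).mem_nhds hp)
  have h1 := hasFDerivWithinAt_comp_extChartAt_symm (f := G.f) p (φ.map_source hp)
    (G.smooth_f.mdifferentiable (by simp) _)
  have h2 := h1.comp_hasDerivWithinAt t (hc.differentiableWithinAt one_ne_zero).hasDerivWithinAt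
    (fun x _ => by simp [extChartAt])
  refine h2.congr_of_eventuallyEq ?_ ?_
  · filter_upwards [hsrc] with t' ht'
    exact congrArg G.f (φ.left_inv ht').symm
  · exact congrArg G.f (φ.left_inv hp).symm

/-! ### The chronology -/

variable (G) in
/-- The chronology, as a relation on the whole cobordism. -/
def Chron (x y : N) : Prop := ∃ γ : ℝ → N, G.IsFutureTimelikePath γ ∧ γ 0 = x ∧ γ 1 = y

theorem isFutureTimelikePath_iff :
    G.IsFutureTimelikePath γ ↔ ∀ t ∈ Icc (0 : ℝ) 1, G.ConeAt γ (Icc 0 1) t := by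
  constructor
  · intro h t ht
    exact ⟨h.contMDiffOn t ht, (G.isFutureTimelike_iff (h.regular t ht) _).1 (h.timelike t ht)⟩
  · intro h
    have hreg : ∀ t ∈ Icc (0 : ℝ) 1, γ t ∉ criticalSet (n := n) G.f := fun t ht =>
      G.regular_of_coneFn_pos (h t ht).2
    exact ⟨fun t ht => (h t ht).1, hreg,
      fun t ht => (G.isFutureTimelike_iff (hreg t ht) _).2 (h t ht).2⟩

/-- Timelike paths may be reparametrized affinely. -/
theorem ConeAt.comp_affine {a b : ℝ} (hb : 0 < b) (h : G.ConeAt γ s (a + t * b))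
    (hs : MapsTo (fun t => a + t * b) s' s) (hu : UniqueDiffWithinAt ℝ s' t) :
    G.ConeAt (fun t => γ (a + t * b)) s' t := by
  have hd : HasDerivWithinAt (fun t : ℝ => a + t * b) b s' t := by
    simpa using (((hasDerivAt_id t).mul_const b).const_add a).hasDerivWithinAt
  have hm : HasMFDerivWithinAt 𝓘(ℝ, ℝ) 𝓘(ℝ, ℝ) (fun t : ℝ => a + t * b) s' t
      (ContinuousLinearMap.toSpanSingleton ℝ b) := hd.hasFDerivWithinAt.hasMFDerivWithinAt
  have hc : ContMDiff 𝓘(ℝ, ℝ) 𝓘(ℝ, ℝ) 1 (fun t : ℝ => a + t * b) := by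
    rw [contMDiff_iff_contDiff]; fun_prop
  have h1 := HasMFDerivWithinAt.comp t h.hasMFDerivWithinAt hm hs
  refine coneAt_of_hasMFDerivWithinAt hu
    (ContMDiffWithinAt.comp t h.1 hc.contMDiffAt.contMDiffWithinAt hs) h1 ?_
  have h2 : G.coneFn (γ (a + t * b)) (b • (mfderivWithin 𝓘(ℝ, ℝ) (𝓡∂ n) γ s (a + t * b) (1 : ℝ))) =
      b * G.coneFn _ _ := coneFn_smul hb.le _
  refine (mul_pos hb h.2).trans_eq (h2.symm.trans (coneFn_congr G rfl ?_))
  have h3 := (mfderivWithin 𝓘(ℝ, ℝ) (𝓡∂ n) γ s (a + t * b)).map_smul b (1 : ℝ)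
  refine h3.symm.trans ?_
  exact congrArg (mfderivWithin 𝓘(ℝ, ℝ) (𝓡∂ n) γ s (a + t * b))
    (show b • (1 : ℝ) = (1 : ℝ) • b by simp)

theorem chron_of_coneAt {a b : ℝ} (hab : a < b) (h : ∀ t ∈ Icc a b, G.ConeAt γ (Icc a b) t) :
    G.Chron (γ a) (γ b) := by
  refine ⟨fun t => γ (a + t * (b - a)), isFutureTimelikePath_iff.2 fun t ht => ?_, by simp,
    by simp⟩
  have hmaps : MapsTo (fun t => a + t * (b - a)) (Icc 0 1) (Icc a b) := by
    intro t ht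
    constructor <;> nlinarith [ht.1, ht.2]
  exact (h _ (hmaps ht)).comp_affine (sub_pos.2 hab) hmaps
    (uniqueDiffOn_Icc zero_lt_one t ht)

theorem chron_of_mem_Icc {a b a' b' : ℝ} (h : ∀ t ∈ Icc a b, G.ConeAt γ (Icc a b) t)
    (ha : a ≤ a') (hab : a' < b') (hb : b' ≤ b) : G.Chron (γ a') (γ b') :=
  chron_of_coneAt hab fun t ht => (h t ⟨ha.trans ht.1, ht.2.trans hb⟩).mono_of_mem
    (Filter.mem_of_superset self_mem_nhdsWithin (Icc_subset_Icc ha hb)) (uniqueDiffOn_Icc hab t ht)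

theorem continuousOn_of_coneAt (h : ∀ t ∈ s, G.ConeAt γ s t) : ContinuousOn γ s :=
  fun t ht => (h t ht).1.continuousWithinAt

theorem strictMonoOn_comp_of_coneAt {a b : ℝ} (h : ∀ t ∈ Icc a b, G.ConeAt γ (Icc a b) t) :
    StrictMonoOn (G.f ∘ γ) (Icc a b) := by
  refine strictMonoOn_of_deriv_pos (convex_Icc a b)
    (G.smooth_f.continuous.comp_continuousOn (continuousOn_of_coneAt h)) fun t ht => ?_
  rw [interior_Icc] at ht
  have ht' := Ioo_subset_Icc_self ht
  rw [((h t ht').hasDerivWithinAt_comp.hasDerivAt (Icc_mem_nhds ht.1 ht.2)).deriv]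
  exact G.differential_pos_of_coneFn_pos (h t ht').2

theorem Chron.lt {x y : N} (h : G.Chron x y) : G.f x < G.f y := by
  obtain ⟨γ, hγ, rfl, rfl⟩ := h
  exact strictMonoOn_comp_of_coneAt (isFutureTimelikePath_iff.1 hγ) (by simp) (by simp)
    zero_lt_one

theorem Chron.exists_mid {x y : N} (h : G.Chron x y) : ∃ z, G.Chron x z ∧ G.Chron z y := by
  obtain ⟨γ, hγ, rfl, rfl⟩ := h
  have h1 := isFutureTimelikePath_iff.1 hγ
  exact ⟨γ (1 / 2), chron_of_mem_Icc h1 le_rfl (by norm_num) (by norm_num),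
    chron_of_mem_Icc h1 (by norm_num) (by norm_num) le_rfl⟩

theorem Chron.regular_left {x y : N} (h : G.Chron x y) : x ∉ criticalSet (n := n) G.f := by
  obtain ⟨γ, hγ, rfl, rfl⟩ := h
  exact hγ.regular 0 (by simp)

theorem Chron.regular_right {x y : N} (h : G.Chron x y) : y ∉ criticalSet (n := n) G.f := by
  obtain ⟨γ, hγ, rfl, rfl⟩ := h
  exact hγ.regular 1 (by simp)

/-- A timelike path, reparametrized so that `f` is affine along it. Only the chronological relations
between its points are recorded. -/
theorem Chron.exists_levels {x y : N} (h : G.Chron x y) :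
    ∃ Γ : ℝ → N, Γ 0 = x ∧ Γ 1 = y ∧
      (∀ s ∈ Icc (0 : ℝ) 1, G.f (Γ s) = (1 - s) * G.f x + s * G.f y) ∧
      ∀ s ∈ Icc (0 : ℝ) 1, ∀ s' ∈ Icc (0 : ℝ) 1, s < s' → G.Chron (Γ s) (Γ s') := by
  have hlt := h.lt
  obtain ⟨γ, hγ, rfl, rfl⟩ := h
  have h1 := isFutureTimelikePath_iff.1 hγ
  have hmono := strictMonoOn_comp_of_coneAt h1
  have hc : ContinuousOn (G.f ∘ γ) (Icc 0 1) :=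
    G.smooth_f.continuous.comp_continuousOn (continuousOn_of_coneAt h1)
  have hex : ∀ s : ℝ, ∃ t, s ∈ Icc (0 : ℝ) 1 →
      t ∈ Icc (0 : ℝ) 1 ∧ G.f (γ t) = (1 - s) * G.f (γ 0) + s * G.f (γ 1) := by
    intro s
    by_cases hs : s ∈ Icc (0 : ℝ) 1
    · obtain ⟨t, ht, ht'⟩ := intermediate_value_Icc zero_le_one hc
        (show (1 - s) * G.f (γ 0) + s * G.f (γ 1) ∈ Icc ((G.f ∘ γ) 0) ((G.f ∘ γ) 1) by
          constructor <;> simp only [Function.comp] <;> nlinarith [hs.1, hs.2])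
      exact ⟨t, fun _ => ⟨ht, ht'⟩⟩
    · exact ⟨0, fun h => absurd h hs⟩
  choose τ hτ using hex
  have h0 : (0 : ℝ) ∈ Icc (0 : ℝ) 1 := by simp
  have h1' : (1 : ℝ) ∈ Icc (0 : ℝ) 1 := by simp
  refine ⟨fun s => γ (τ s), ?_, ?_, fun s hs => (hτ s hs).2, fun s hs s' hs' hss => ?_⟩
  · have := hmono.injOn (hτ 0 h0).1 h0 (by simp [(hτ 0 h0).2])
    simp [this]
  · have := hmono.injOn (hτ 1 h1').1 h1' (by simp [(hτ 1 h1').2])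
    simp [this]
  · refine chron_of_mem_Icc h1 (hτ s hs).1.1 ?_ (hτ s' hs').1.2
    rw [← hmono.lt_iff_lt (hτ s hs).1 (hτ s' hs').1]
    simp only [Function.comp, (hτ s hs).2, (hτ s' hs').2]
    nlinarith

end MorseGeometry

namespace MorseGeometry
variable {n : ℕ} [NeZero n] {N : Type*} [TopologicalSpace N] [T2Space N] [CompactSpace N]
  [ChartedSpace (EuclideanHalfSpace n) N] [IsManifold (𝓡∂ n) ∞ N] {G : MorseGeometry n N}

local notation "𝔼" => EuclideanSpace ℝ (Fin n)

/-! ### Functions that vary more slowly than the Morse function -/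

/-- Around a regular point there are bump functions whose variation along timelike paths is
controlled by the variation of the Morse function. -/
theorem exists_slow_function {p : N} (hp : p ∉ criticalSet (n := n) G.f) {W : Set N}
    (hW : W ∈ 𝓝 p) :
    ∃ g : N → ℝ, Continuous g ∧ 0 < g p ∧ (∀ x ∉ W, g x = 0) ∧
      ∀ x y, G.Chron x y → |g y - g x| ≤ G.f y - G.f x := by
  obtain ⟨r, hr, K, q, V, hcone, -⟩ := G.exists_isConeField_chartCone hp
  set φ := extChartAt (𝓡∂ n) p with hφ
  have hW' : W ∩ (φ.source ∩ φ ⁻¹' Metric.ball (φ p) r) ∈ 𝓝 p := by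
    refine Filter.inter_mem hW (Filter.inter_mem (extChartAt_source_mem_nhds p) ?_)
    exact (continuousAt_extChartAt p).preimage_mem_nhds (Metric.ball_mem_nhds _ hr)
  obtain ⟨ψ, -, hψ⟩ := (SmoothBumpFunction.nhds_basis_tsupport (I := 𝓡∂ n) p).mem_iff.1 hW'
  obtain ⟨C, hC⟩ := (ψ.toContDiffBump.contDiff (n := 1)).lipschitzWith_of_hasCompactSupport
    ψ.toContDiffBump.hasCompactSupport one_ne_zero
  -- a timelike vector `v` satisfies `|dψ v| ≤ C ‖v‖ ≤ C K df(v)`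
  set M : ℝ := (C + 1) * K with hM
  have hK := hcone.K_pos
  have hMpos : 0 < M := by positivity
  refine ⟨fun x => ψ x / M, ψ.continuous.div_const M, ?_, ?_, ?_⟩
  · simp only [ψ.eq_one]; positivity
  · intro x hx
    have : ψ x = 0 := image_eq_zero_of_notMem_tsupport fun h => hx (hψ h).1
    simp [this]
  · rintro _ _ ⟨γ, hγ, rfl, rfl⟩
    have h1 := isFutureTimelikePath_iff.1 hγ
    have hu : UniqueDiffOn ℝ (Icc (0 : ℝ) 1) := uniqueDiffOn_Icc zero_lt_one
    have key : ∀ t ∈ Icc (0 : ℝ) 1, ∃ d e : ℝ, HasDerivWithinAt (ψ ∘ γ) d (Icc 0 1) t ∧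
        HasDerivWithinAt (G.f ∘ γ) e (Icc 0 1) t ∧ |d| ≤ M * e := by
      intro t ht
      have hct : ContinuousWithinAt γ (Icc 0 1) t := (h1 t ht).1.continuousWithinAt
      by_cases hsupp : γ t ∈ tsupport ψ
      · obtain ⟨-, hsrc, hball⟩ := hψ hsupp
        obtain ⟨hc, hQ⟩ := (h1 t ht).chart (hu t ht) hsrc
        have hD := (h1 t ht).hasDerivWithinAt_chart (hu t ht) hsrc
        have hn := hcone.norm_le (φ (γ t)) ⟨hball, by simp [hφ, extChartAt]⟩ _ hQ
        set v := derivWithin (φ ∘ γ) (Icc 0 1) t with hv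
        refine ⟨fderiv ℝ ψ.toContDiffBump (φ (γ t)) v, _, ?_, hD, ?_⟩
        · have h2 := ((ψ.toContDiffBump.contDiff (n := 1)).differentiable one_ne_zero
            (φ (γ t))).hasFDerivAt.comp_hasDerivWithinAt t
            (hc.differentiableWithinAt one_ne_zero).hasDerivWithinAt
          have hev : ∀ᶠ t' in 𝓝[Icc 0 1] t, γ t' ∈ φ.source :=
            hct.eventually ((isOpen_extChartAt_source p).mem_nhds hsrc)
          refine h2.congr_of_eventuallyEq ?_ (ψ.eqOn_source (by rwa [extChartAt_source] at hsrc))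
          filter_upwards [hev] with t' ht'
          exact ψ.eqOn_source (by rwa [extChartAt_source] at ht')
        · have h3 : ‖fderiv ℝ ψ.toContDiffBump (φ (γ t))‖ ≤ C :=
            norm_fderiv_le_of_lipschitz ℝ hC
          calc |fderiv ℝ ψ.toContDiffBump (φ (γ t)) v|
              ≤ ‖fderiv ℝ ψ.toContDiffBump (φ (γ t))‖ * ‖v‖ :=
                (fderiv ℝ ψ.toContDiffBump (φ (γ t))).le_opNorm v
            _ ≤ (C + 1) * (K * _) := by
                refine mul_le_mul (by linarith) hn (norm_nonneg _) (by positivity)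
            _ = _ := by rw [hM]; ring
      · refine ⟨0, _, ?_, (h1 t ht).hasDerivWithinAt_comp, ?_⟩
        · have hev : ∀ᶠ t' in 𝓝[Icc 0 1] t, γ t' ∈ (tsupport ψ)ᶜ :=
            hct.eventually ((isClosed_tsupport ψ).isOpen_compl.mem_nhds hsupp)
          refine (hasDerivWithinAt_const t (Icc 0 1) (0 : ℝ)).congr_of_eventuallyEq ?_
            (image_eq_zero_of_notMem_tsupport (f := ψ) hsupp)
          filter_upwards [hev] with t' ht'
          exact image_eq_zero_of_notMem_tsupport (f := ψ) ht'
        · have := G.differential_pos_of_coneFn_pos (h1 t ht).2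
          simp only [abs_zero]
          positivity
    choose! d e hd he hde using key
    have hmono : ∀ σ : ℝ, |σ| ≤ 1 →
        MonotoneOn (fun t => M * G.f (γ t) - σ * ψ (γ t)) (Icc 0 1) := by
      intro σ hσ
      have hdiff : ∀ t ∈ Icc (0 : ℝ) 1, HasDerivWithinAt (fun t => M * G.f (γ t) - σ * ψ (γ t))
          (M * e t - σ * d t) (Icc 0 1) t := fun t ht =>
        ((he t ht).const_mul M).sub ((hd t ht).const_mul σ)
      refine monotoneOn_of_hasDerivWithinAt_nonneg (f' := fun t => M * e t - σ * d t)
        (convex_Icc 0 1) (fun t ht => (hdiff t ht).continuousWithinAt)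
        (fun t ht => (hdiff t (interior_subset ht)).mono interior_subset) fun t ht => ?_
      have h2 := hde t (interior_subset ht)
      have h3 : |σ * d t| ≤ |d t| := by
        rw [abs_mul]; exact mul_le_of_le_one_left (abs_nonneg _) hσ
      linarith [le_abs_self (σ * d t)]
    have h2 := hmono 1 (by simp) (by simp : (0 : ℝ) ∈ Icc (0 : ℝ) 1)
      (by simp : (1 : ℝ) ∈ Icc (0 : ℝ) 1) zero_le_one
    have h3 := hmono (-1) (by simp) (by simp : (0 : ℝ) ∈ Icc (0 : ℝ) 1)
      (by simp : (1 : ℝ) ∈ Icc (0 : ℝ) 1) zero_le_one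
    simp only at h2 h3
    rw [← sub_div, abs_div, abs_of_pos hMpos, div_le_iff₀ hMpos, abs_le]
    constructor <;> linarith

end MorseGeometry

/-! ### Smoothing a corner -/

section Corner

variable {E : Type*} [NormedAddCommGroup E] [NormedSpace ℝ E]

theorem IsConeField.lower_bound {Q D : E → E → ℝ} {U : Set E} {K q : ℝ} {V : E}
    (h : IsConeField Q D U K q V) {ξ η : E} (hξ : ξ ∈ U) (hη : η ∈ U) (u v : E) :
    Q ξ v - K * ‖η - ξ‖ * ‖v‖ - K * ‖u - v‖ ≤ Q η u := by
  have h1 := (abs_le.1 (h.lip η hη ξ hξ v)).1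
  have h2 := (abs_le.1 (h.bdd η hη (u - v))).1
  have h3 := h.add_le η hη v (u - v)
  rw [add_sub_cancel] at h3
  linarith

theorem hasDerivAt_max_zero_sq (u : ℝ) :
    HasDerivAt (fun u : ℝ => max u 0 ^ 2) (2 * max u 0) u := by
  rcases lt_trichotomy u 0 with h | rfl | h
  · rw [max_eq_right h.le, mul_zero]
    refine (hasDerivAt_const u (0 : ℝ)).congr_of_eventuallyEq ?_
    filter_upwards [gt_mem_nhds h] with x hx
    simp [max_eq_right hx.le]
  · have h1 : (fun u : ℝ => max u 0 ^ 2) =O[𝓝 0] fun x => ‖x - 0‖ ^ 2 := by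
      refine Asymptotics.IsBigO.of_bound 1 (Filter.Eventually.of_forall fun x => ?_)
      rw [Real.norm_eq_abs, Real.norm_eq_abs, Real.norm_eq_abs, sub_zero, one_mul,
        abs_of_nonneg (by positivity), abs_of_nonneg (by positivity)]
      exact pow_le_pow_left₀ (le_max_right _ _) (max_le (le_abs_self x) (abs_nonneg x)) 2
    have h2 := (h1.hasFDerivAt one_lt_two).hasDerivAt
    simpa using h2
  · rw [max_eq_left h.le]
    have h1 : HasDerivAt (fun x : ℝ => x ^ 2) (2 * u) u := by simpa using hasDerivAt_pow 2 u
    refine h1.congr_of_eventuallyEq ?_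
    filter_upwards [lt_mem_nhds h] with x hx
    simp [max_eq_left hx.le]

/-- Two `C¹` curves with matching values and velocities form a `C¹` curve. -/
theorem contDiffOn_glue {f₁ f₂ f₁' f₂' : ℝ → E} {a : ℝ}
    (h₁ : ∀ t ∈ Icc (-a) 0, HasDerivWithinAt f₁ (f₁' t) (Icc (-a) 0) t)
    (h₂ : ∀ t ∈ Icc 0 a, HasDerivWithinAt f₂ (f₂' t) (Icc 0 a) t)
    (hc₁ : ContinuousOn f₁' (Icc (-a) 0)) (hc₂ : ContinuousOn f₂' (Icc 0 a))
    (he : f₁ 0 = f₂ 0) (he' : f₁' 0 = f₂' 0) :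
    (∀ t ∈ Ioo (-a) a, HasDerivAt (fun t => if t ≤ 0 then f₁ t else f₂ t)
      (if t ≤ 0 then f₁' t else f₂' t) t) ∧
    ContDiffOn ℝ 1 (fun t => if t ≤ 0 then f₁ t else f₂ t) (Ioo (-a) a) := by
  have hd : ∀ t ∈ Ioo (-a) a, HasDerivAt (fun t => if t ≤ 0 then f₁ t else f₂ t)
      (if t ≤ 0 then f₁' t else f₂' t) t := by
    intro t ht
    rcases lt_trichotomy t 0 with h | rfl | h
    · rw [if_pos h.le]
      refine ((h₁ t ⟨ht.1.le, h.le⟩).hasDerivAt (Icc_mem_nhds ht.1 h)).congr_of_eventuallyEq ?_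
      filter_upwards [gt_mem_nhds h] with x hx
      rw [if_pos hx.le]
    · have ha : 0 < a := ht.2
      rw [if_pos le_rfl, ← hasDerivWithinAt_univ, ← Iic_union_Ici (a := (0 : ℝ))]
      refine HasDerivWithinAt.union ?_ ?_
      · have h1 := (h₁ 0 ⟨ht.1.le, le_rfl⟩).mono_of_mem_nhdsWithin
          (Icc_mem_nhdsLE ht.1)
        exact h1.congr (fun x hx => if_pos hx) (if_pos le_rfl)
      · have h1 := (h₂ 0 ⟨le_rfl, ht.2.le⟩).mono_of_mem_nhdsWithin
          (Icc_mem_nhdsGE ht.2)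
        rw [he']
        refine h1.congr (fun x hx => ?_) ?_
        · rcases (mem_Ici.1 hx).eq_or_lt with rfl | hx'
          · simp [he]
          · simp [hx']
        · simp [he]
    · rw [if_neg h.not_ge]
      refine ((h₂ t ⟨h.le, ht.2.le⟩).hasDerivAt (Icc_mem_nhds h ht.2)).congr_of_eventuallyEq ?_
      filter_upwards [lt_mem_nhds h] with x hx
      rw [if_neg hx.not_ge]
  refine ⟨hd, ?_⟩
  have hc : ContinuousOn (fun t => if t ≤ 0 then f₁' t else f₂' t) (Ioo (-a) a) := by
    intro t ht
    refine ContinuousAt.continuousWithinAt ?_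
    rcases lt_trichotomy t 0 with h | rfl | h
    · refine ((hc₁ t ⟨ht.1.le, h.le⟩).continuousAt (Icc_mem_nhds ht.1 h)).congr ?_
      filter_upwards [gt_mem_nhds h] with x hx
      rw [if_pos hx.le]
    · rw [continuousAt_iff_continuous_left_right]
      constructor
      · exact ((hc₁ 0 ⟨ht.1.le, le_rfl⟩).mono_of_mem_nhdsWithin (Icc_mem_nhdsLE ht.1)).congr
          (fun x hx => if_pos hx) (if_pos le_rfl)
      · refine ((hc₂ 0 ⟨le_rfl, ht.2.le⟩).mono_of_mem_nhdsWithin (Icc_mem_nhdsGE ht.2)).congr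
          (fun x hx => ?_) ?_
        · rcases (mem_Ici.1 hx).eq_or_lt with rfl | hx'
          · simp [he']
          · simp [hx']
        · simp [he']
    · refine ((hc₂ t ⟨h.le, ht.2.le⟩).continuousAt (Icc_mem_nhds h ht.2)).congr ?_
      filter_upwards [lt_mem_nhds h] with x hx
      rw [if_neg hx.not_ge]
  have h1 : ContDiffOn ℝ (0 + 1) (fun t => if t ≤ 0 then f₁ t else f₂ t) (Ioo (-a) a) := by
    rw [contDiffOn_succ_iff_deriv_of_isOpen isOpen_Ioo]
    refine ⟨fun t ht => (hd t ht).differentiableAt.differentiableWithinAt, by simp, ?_⟩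
    rw [contDiffOn_zero]
    exact hc.congr fun t ht => (hd t ht).deriv
  simpa using h1

/-- A corner between two curves in the cones can be smoothed, within the cones and without moving
the curves away from the corner. -/
theorem IsConeField.exists_smooth_corner {Q D : E → E → ℝ} {ξ : E} {r K q : ℝ} {V : E}
    (h : IsConeField Q D (Metric.ball ξ r) K q V) (hr : 0 < r) {c₁ c₂ : ℝ → E} {a : ℝ} (ha : 0 < a)
    (h₁ : ContDiffOn ℝ 1 c₁ (Icc (-a) 0)) (h₂ : ContDiffOn ℝ 1 c₂ (Icc 0 a))
    (e₁ : c₁ 0 = ξ) (e₂ : c₂ 0 = ξ) (hQ₁ : 0 < Q ξ (derivWithin c₁ (Icc (-a) 0) 0))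
    (hQ₂ : 0 < Q ξ (derivWithin c₂ (Icc 0 a) 0)) :
    ∃ δ ∈ Ioo 0 a, ∃ C : ℝ → E, ContDiffOn ℝ 1 C (Ioo (-a) a) ∧
      (∀ t ≤ -δ, C t = c₁ t) ∧ (∀ t ≥ δ, C t = c₂ t) ∧
      ∀ t ∈ Icc (-δ) δ, C t ∈ Metric.ball ξ r ∧ 0 < Q (C t) (deriv C t) := by
  set c₁' := derivWithin c₁ (Icc (-a) 0) with hc₁'
  set c₂' := derivWithin c₂ (Icc 0 a) with hc₂'
  have hu₁ : UniqueDiffOn ℝ (Icc (-a) 0) := uniqueDiffOn_Icc (by linarith)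
  have hu₂ : UniqueDiffOn ℝ (Icc 0 a) := uniqueDiffOn_Icc ha
  have hcc₁ : ContinuousOn c₁' (Icc (-a) 0) := h₁.continuousOn_derivWithin hu₁ le_rfl
  have hcc₂ : ContinuousOn c₂' (Icc 0 a) := h₂.continuousOn_derivWithin hu₂ le_rfl
  have hd₁ : ∀ t ∈ Icc (-a) 0, HasDerivWithinAt c₁ (c₁' t) (Icc (-a) 0) t := fun t ht =>
    (h₁.differentiableOn one_ne_zero t ht).hasDerivWithinAt
  have hd₂ : ∀ t ∈ Icc 0 a, HasDerivWithinAt c₂ (c₂' t) (Icc 0 a) t := fun t ht =>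
    (h₂.differentiableOn one_ne_zero t ht).hasDerivWithinAt
  set v₁ := c₁' 0 with hv₁
  set v₂ := c₂' 0 with hv₂
  set w := v₂ - v₁ with hw
  set m := min (Q ξ v₁) (Q ξ v₂) with hm
  have hmpos : 0 < m := lt_min hQ₁ hQ₂
  have hξ : ξ ∈ Metric.ball ξ r := Metric.mem_ball_self hr
  have hK := h.K_pos
  set R := ‖v₁‖ + ‖v₂‖ with hR
  have hR0 : 0 ≤ R := by positivity
  -- the tolerance `η` for the position (up to a factor 2) and for the velocity
  obtain ⟨η, hη, hηr, hηm⟩ : ∃ η > 0, 2 * η < r ∧ K * (2 * η) * R + K * η < m := by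
    refine ⟨min (r / 4) (m / (2 * (K * 2 * R + K))), by positivity, ?_, ?_⟩
    · have := min_le_left (r / 4) (m / (2 * (K * 2 * R + K)))
      linarith
    · have h3 := min_le_right (r / 4) (m / (2 * (K * 2 * R + K)))
      calc K * (2 * _) * R + K * _ = (K * 2 * R + K) * min (r / 4) (m / (2 * (K * 2 * R + K))) := by
            ring
        _ ≤ (K * 2 * R + K) * (m / (2 * (K * 2 * R + K))) := by gcongr
        _ = m / 2 := by field_simp
        _ < m := by linarith
  have hnear : ∀ s ∈ Icc (0 : ℝ) 1, ∀ ζ u, ‖ζ - ξ‖ < 2 * η → ‖u - (v₁ + s • w)‖ < η →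
      ζ ∈ Metric.ball ξ r ∧ 0 < Q ζ u := by
    intro s hs ζ u hζ hu
    have hζ' : ζ ∈ Metric.ball ξ r := by rw [mem_ball_iff_norm]; linarith
    refine ⟨hζ', ?_⟩
    have e : v₁ + s • w = (1 - s) • v₁ + s • v₂ := by rw [hw]; module
    have h3 : m ≤ Q ξ (v₁ + s • w) := by
      rw [e]
      refine le_trans ?_ (h.add_le ξ hξ _ _)
      rw [h.smul_eq ξ hξ _ (by linarith [hs.2]), h.smul_eq ξ hξ _ hs.1]
      have := min_le_left (Q ξ v₁) (Q ξ v₂)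
      have := min_le_right (Q ξ v₁) (Q ξ v₂)
      nlinarith [hs.1, hs.2]
    have h4 : ‖v₁ + s • w‖ ≤ R := by
      rw [e]
      refine (norm_add_le _ _).trans ?_
      rw [norm_smul, norm_smul, Real.norm_of_nonneg hs.1,
        Real.norm_of_nonneg (by linarith [hs.2] : (0 : ℝ) ≤ 1 - s), hR]
      nlinarith [hs.1, hs.2, norm_nonneg v₁, norm_nonneg v₂]
    have h5 := h.lower_bound hξ hζ' u (v₁ + s • w)
    have h6 : K * ‖ζ - ξ‖ * ‖v₁ + s • w‖ ≤ K * (2 * η) * R := by gcongr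
    have h7 : K * ‖u - (v₁ + s • w)‖ ≤ K * η := by gcongr
    linarith
  have hev₁ : ∀ᶠ t in 𝓝[Icc (-a) 0] 0, ‖c₁ t - ξ‖ < η ∧ ‖c₁' t - v₁‖ < η := by
    have h0 : (0 : ℝ) ∈ Icc (-a) 0 := by simp [ha.le]
    have h3 := (h₁.continuousOn 0 h0).eventually (Metric.ball_mem_nhds _ hη)
    have h4 := (hcc₁ 0 h0).eventually (Metric.ball_mem_nhds _ hη)
    filter_upwards [h3, h4] with t ht ht'
    rw [dist_eq_norm] at ht ht'
    exact ⟨by rwa [e₁] at ht, ht'⟩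
  have hev₂ : ∀ᶠ t in 𝓝[Icc 0 a] 0, ‖c₂ t - ξ‖ < η ∧ ‖c₂' t - v₂‖ < η := by
    have h0 : (0 : ℝ) ∈ Icc 0 a := by simp [ha.le]
    have h3 := (h₂.continuousOn 0 h0).eventually (Metric.ball_mem_nhds _ hη)
    have h4 := (hcc₂ 0 h0).eventually (Metric.ball_mem_nhds _ hη)
    filter_upwards [h3, h4] with t ht ht'
    rw [dist_eq_norm] at ht ht'
    exact ⟨by rwa [e₂] at ht, ht'⟩
  obtain ⟨ρ₁, hρ₁, hb₁⟩ := Metric.mem_nhdsWithin_iff.1 hev₁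
  obtain ⟨ρ₂, hρ₂, hb₂⟩ := Metric.mem_nhdsWithin_iff.1 hev₂
  obtain ⟨δ, hδ0, hδ⟩ := exists_between (show 0 < min (min a (min ρ₁ ρ₂)) (η / (‖w‖ + 1)) by
    positivity)
  obtain ⟨⟨hδa, hδ₁, hδ₂⟩, hδw⟩ : (δ < a ∧ δ < ρ₁ ∧ δ < ρ₂) ∧ δ * (‖w‖ + 1) < η := by
    rw [← lt_div_iff₀ (by positivity)]
    simpa only [lt_min_iff] using hδ
  -- `k` vanishes before `-δ` and has slope `1 / 2` at `0`; adding `k t • w` to `c₁` and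
  -- `k (-t) • w` to `c₂` turns both velocities at `0` into the mean of `v₁` and `v₂`
  set k : ℝ → ℝ := fun u => max (δ + u) 0 ^ 2 / (4 * δ) with hk
  set k' : ℝ → ℝ := fun u => max (δ + u) 0 / (2 * δ) with hk'
  have hkd : ∀ u, HasDerivAt k (k' u) u := by
    intro u
    have h3 := ((hasDerivAt_max_zero_sq (δ + u)).comp u ((hasDerivAt_id u).const_add δ)).div_const
      (4 * δ)
    have e : 2 * max (δ + u) 0 * 1 / (4 * δ) = k' u := by
      rw [hk']; field_simp; ring
    rw [e] at h3
    exact h3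
  have hkc : Continuous k' := by rw [hk']; fun_prop
  have hkd' : ∀ u, HasDerivAt (fun u => k (-u)) (-k' (-u)) u := by
    intro u
    have := (hkd (-u)).comp u (hasDerivAt_neg u)
    rw [mul_neg_one] at this
    exact this
  have hk0 : ∀ u ≤ -δ, k u = 0 := by
    intro u hu
    simp only [hk]
    rw [max_eq_right (by linarith)]; simp
  have hkb : ∀ u ∈ Icc (-δ) 0, k u * ‖w‖ < η ∧ 0 ≤ k u ∧ k' u ∈ Icc (0 : ℝ) (1 / 2) := by
    intro u hu
    have h3 : max (δ + u) 0 = δ + u := max_eq_left (by linarith [hu.1])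
    have h4 : k u ≤ δ := by
      simp only [hk, h3]
      rw [div_le_iff₀ (by positivity)]
      nlinarith [hu.1, hu.2]
    refine ⟨?_, by positivity, by positivity, ?_⟩
    · calc k u * ‖w‖ ≤ δ * (‖w‖ + 1) := by gcongr; linarith
        _ < η := hδw
    · simp only [hk', h3]
      rw [div_le_iff₀ (by positivity)]
      linarith [hu.2]
  have hk'0 : k' 0 = 1 / 2 := by
    simp only [hk', add_zero, max_eq_left hδ0.le]
    field_simp
  obtain ⟨hderiv, hcont⟩ := contDiffOn_glue (f₁ := fun t => c₁ t + k t • w)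
    (f₂ := fun t => c₂ t + k (-t) • w) (f₁' := fun t => c₁' t + k' t • w)
    (f₂' := fun t => c₂' t + (-k' (-t)) • w) (a := a)
    (fun t ht => (hd₁ t ht).add ((hkd t).smul_const w).hasDerivWithinAt)
    (fun t ht => (hd₂ t ht).add ((hkd' t).smul_const w).hasDerivWithinAt)
    (hcc₁.add (by fun_prop)) (hcc₂.add (by fun_prop)) (by simp [e₁, e₂])
    (by
      simp only [neg_zero, hk'0]
      rw [← hv₁, ← hv₂, hw]
      module)
  refine ⟨δ, ⟨hδ0, hδa⟩, _, hcont, ?_, ?_, ?_⟩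
  · intro t ht
    simp only [if_pos (show t ≤ 0 by linarith), hk0 t ht, zero_smul, add_zero]
  · intro t ht
    simp only [if_neg (show ¬ t ≤ 0 by linarith), hk0 (-t) (by linarith), zero_smul, add_zero]
  · intro t ht
    rw [(hderiv t ⟨by linarith [ht.1], by linarith [ht.2]⟩).deriv]
    by_cases h0 : t ≤ 0
    · simp only [if_pos h0]
      obtain ⟨hb, hk0', hs⟩ := hkb t ⟨ht.1, h0⟩
      obtain ⟨h3, h4⟩ := hb₁ (show t ∈ Metric.ball 0 ρ₁ ∩ Icc (-a) 0 from
        ⟨by rw [mem_ball_zero_iff, Real.norm_eq_abs, abs_lt]; constructor <;> linarith [ht.1],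
          by linarith [ht.1], h0⟩)
      refine hnear (k' t) ⟨hs.1, by linarith [hs.2]⟩ _ _ ?_ ?_
      · rw [add_sub_right_comm]
        refine (norm_add_le _ _).trans_lt ?_
        rw [norm_smul, Real.norm_of_nonneg hk0']
        linarith
      · rwa [add_sub_add_right_eq_sub]
    · simp only [if_neg h0]
      have h0' : 0 < t := not_le.1 h0
      obtain ⟨hb, hk0', hs⟩ := hkb (-t) ⟨by linarith [ht.2], by linarith⟩
      obtain ⟨h3, h4⟩ := hb₂ (show t ∈ Metric.ball 0 ρ₂ ∩ Icc 0 a from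
        ⟨by rw [mem_ball_zero_iff, Real.norm_eq_abs, abs_lt]; constructor <;> linarith [ht.2],
          h0'.le, by linarith [ht.2]⟩)
      refine hnear (1 - k' (-t)) ⟨by linarith [hs.2], by linarith [hs.1]⟩ _ _ ?_ ?_
      · rw [add_sub_right_comm]
        refine (norm_add_le _ _).trans_lt ?_
        rw [norm_smul, Real.norm_of_nonneg hk0']
        linarith
      · have e : c₂' t + (-k' (-t)) • w - (v₁ + (1 - k' (-t)) • w) = c₂' t - v₂ := by
          rw [hw]; module
        rwa [e]

end Corner

namespace MorseGeometry
variable {n : ℕ} [NeZero n] {N : Type*} [TopologicalSpace N] [T2Space N] [CompactSpace N]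
  [ChartedSpace (EuclideanHalfSpace n) N] [IsManifold (𝓡∂ n) ∞ N] {G : MorseGeometry n N}

local notation "𝔼" => EuclideanSpace ℝ (Fin n)

/-! ### Transitivity and openness of the chronology -/

theorem isInteriorPoint_of_mem_Ioo {p : N} (h : G.f p ∈ Ioo (0 : ℝ) 1) :
    (𝓡∂ n).IsInteriorPoint p := by
  have h1 : p ∉ (𝓡∂ n).boundary N := by
    rw [G.boundary_eq, ← G.f_preimage_zero, ← G.f_preimage_one]
    rintro (h0 | h0)
    · exact h.1.ne' h0
    · exact h.2.ne h0
  rw [← mem_compl_iff, ModelWithCorners.compl_boundary] at h1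
  exact h1

theorem mem_Ioo_of_notMem_boundary {p : N} (h : p ∉ (𝓡∂ n).boundary N) :
    G.f p ∈ Ioo (0 : ℝ) 1 := by
  rw [G.boundary_eq, ← G.f_preimage_zero, ← G.f_preimage_one] at h
  simp only [mem_union, mem_preimage, mem_singleton_iff, not_or] at h
  have h1 := G.f_mem p
  exact ⟨lt_of_le_of_ne h1.1 (Ne.symm h.1), lt_of_le_of_ne h1.2 h.2⟩

/-- At an interior point, the cone field is defined on a full ball of the chart. -/
theorem exists_isConeField_ball {p : N} (hp : p ∉ criticalSet (n := n) G.f)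
    (h : G.f p ∈ Ioo (0 : ℝ) 1) :
    ∃ r > 0, ∃ K q V, IsConeField (G.chartCone p) (fun ξ v => chartDifferential G.f p ξ v)
      (Metric.ball (extChartAt (𝓡∂ n) p p) r) K q V ∧
      Metric.ball (extChartAt (𝓡∂ n) p p) r ⊆ (extChartAt (𝓡∂ n) p).target := by
  obtain ⟨r, hr, K, q, V, hcone, hsub⟩ := G.exists_isConeField_chartCone hp
  obtain ⟨r', hr', hball⟩ := Metric.mem_nhds_iff.1
    (mem_interior_iff_mem_nhds.1 (isInteriorPoint_of_mem_Ioo h))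
  have h1 : Metric.ball (extChartAt (𝓡∂ n) p p) (min r r') ⊆
      Metric.ball (extChartAt (𝓡∂ n) p p) r ∩ range (𝓡∂ n) :=
    subset_inter (Metric.ball_subset_ball (min_le_left _ _))
      ((Metric.ball_subset_ball (min_le_right _ _)).trans hball)
  exact ⟨min r r', lt_min hr hr', K, q, V, hcone.mono h1, h1.trans hsub⟩

/-- Curves in a chart that are timelike in coordinates join chronologically related points. -/
theorem chron_of_chart {p : N} {c c' : ℝ → 𝔼} (hc : ContDiffOn ℝ 1 c (Icc 0 1))
    (hc' : ∀ t ∈ Icc (0 : ℝ) 1, HasDerivWithinAt c (c' t) (Icc 0 1) t)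
    (hmem : ∀ t ∈ Icc (0 : ℝ) 1, c t ∈ (extChartAt (𝓡∂ n) p).target)
    (h : ∀ t ∈ Icc (0 : ℝ) 1, 0 < G.chartCone p (c t) (c' t)) :
    G.Chron ((extChartAt (𝓡∂ n) p).symm (c 0)) ((extChartAt (𝓡∂ n) p).symm (c 1)) := by
  have hu : UniqueDiffOn ℝ (Icc (0 : ℝ) 1) := uniqueDiffOn_Icc zero_lt_one
  refine chron_of_coneAt (γ := (extChartAt (𝓡∂ n) p).symm ∘ c) zero_lt_one fun t ht => ?_
  refine coneAt_of_chart (hu t ht) (hc t ht) (hmem t ht) ?_ ?_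
  · filter_upwards [self_mem_nhdsWithin] with t' ht' using hmem t' ht'
  · rw [(hc' t ht).derivWithin (hu t ht)]
    exact h t ht

/-- A timelike path that stays in the domain of a chart is a `C¹` curve in coordinates. -/
theorem contDiffOn_chart {γ : ℝ → N} {s s' : Set ℝ} {p : N} (h : ∀ t ∈ s, G.ConeAt γ s t)
    (hs : s' ⊆ s) (hu : UniqueDiffOn ℝ s)
    (hsrc : ∀ t ∈ s', γ t ∈ (extChartAt (𝓡∂ n) p).source) :
    ContDiffOn ℝ 1 (extChartAt (𝓡∂ n) p ∘ γ) s' :=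
  fun t ht => ((h t (hs ht)).chart (hu t (hs ht)) (hsrc t ht)).1.mono hs

theorem Chron.trans {x p y : N} (hxp : G.Chron x p) (hpy : G.Chron p y) : G.Chron x y := by
  have hpI : G.f p ∈ Ioo (0 : ℝ) 1 :=
    ⟨(G.f_mem x).1.trans_lt hxp.lt, hpy.lt.trans_le (G.f_mem y).2⟩
  obtain ⟨r, hr, K, q, V, hcone, hball⟩ := exists_isConeField_ball hxp.regular_right hpI
  set φ := extChartAt (𝓡∂ n) p with hφ
  -- the paths are parametrized so that they meet at time `0`
  obtain ⟨γ₁, h₁, rfl, h₁p⟩ : ∃ γ : ℝ → N, (∀ t ∈ Icc (-1 : ℝ) 0, G.ConeAt γ (Icc (-1) 0) t) ∧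
      γ (-1) = x ∧ γ 0 = p := by
    obtain ⟨γ, hγ, h0, h1⟩ := hxp
    refine ⟨fun t => γ (1 + t * 1), fun t ht => ?_, by simpa using h0, by simpa using h1⟩
    have hmaps : MapsTo (fun t : ℝ => 1 + t * 1) (Icc (-1) 0) (Icc 0 1) := by
      intro t ht; constructor <;> linarith [ht.1, ht.2]
    exact (isFutureTimelikePath_iff.1 hγ _ (hmaps ht)).comp_affine one_pos hmaps
      (uniqueDiffOn_Icc (by norm_num) t ht)
  obtain ⟨γ₂, hγ₂, h₂p, rfl⟩ := hpy
  have h₂ := isFutureTimelikePath_iff.1 hγ₂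
  have hu₁ : UniqueDiffOn ℝ (Icc (-1 : ℝ) 0) := uniqueDiffOn_Icc (by norm_num)
  have hu₂ : UniqueDiffOn ℝ (Icc (0 : ℝ) 1) := uniqueDiffOn_Icc (by norm_num)
  have hpsrc : p ∈ φ.source := mem_extChartAt_source p
  obtain ⟨a, ha0, ha1, hsrc₁, hsrc₂⟩ : ∃ a > 0, a < (1 : ℝ) ∧
      (∀ t ∈ Icc (-a) 0, γ₁ t ∈ φ.source) ∧ ∀ t ∈ Icc 0 a, γ₂ t ∈ φ.source := by
    have e₁ : ∀ᶠ t in 𝓝[Icc (-1) 0] (0 : ℝ), γ₁ t ∈ φ.source :=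
      (h₁ 0 (by simp)).1.continuousWithinAt.eventually
        ((isOpen_extChartAt_source p).mem_nhds (by rwa [h₁p]))
    have e₂ : ∀ᶠ t in 𝓝[Icc 0 1] (0 : ℝ), γ₂ t ∈ φ.source :=
      (h₂ 0 (by simp)).1.continuousWithinAt.eventually
        ((isOpen_extChartAt_source p).mem_nhds (by rwa [h₂p]))
    obtain ⟨ρ₁, hρ₁, hb₁⟩ := Metric.mem_nhdsWithin_iff.1 e₁
    obtain ⟨ρ₂, hρ₂, hb₂⟩ := Metric.mem_nhdsWithin_iff.1 e₂
    obtain ⟨a, ha0, ha⟩ := exists_between (show 0 < min 1 (min ρ₁ ρ₂) by positivity)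
    obtain ⟨ha1, ha2, ha3⟩ : a < 1 ∧ a < ρ₁ ∧ a < ρ₂ := by simpa only [lt_min_iff] using ha
    refine ⟨a, ha0, ha1, fun t ht => hb₁ ⟨?_, ?_⟩, fun t ht => hb₂ ⟨?_, ?_⟩⟩
    · rw [mem_ball_zero_iff, Real.norm_eq_abs, abs_lt]; constructor <;> linarith [ht.1, ht.2]
    · exact ⟨by linarith [ht.1], ht.2⟩
    · rw [mem_ball_zero_iff, Real.norm_eq_abs, abs_lt]; constructor <;> linarith [ht.1, ht.2]
    · exact ⟨ht.1, by linarith [ht.2]⟩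
  have hs₁ : Icc (-a) 0 ⊆ Icc (-1 : ℝ) 0 := Icc_subset_Icc (by linarith) le_rfl
  have hs₂ : Icc 0 a ⊆ Icc (0 : ℝ) 1 := Icc_subset_Icc le_rfl ha1.le
  have h₁' : ∀ t ∈ Icc (-a) 0, G.ConeAt γ₁ (Icc (-a) 0) t := fun t ht =>
    (h₁ t (hs₁ ht)).mono_of_mem (Filter.mem_of_superset self_mem_nhdsWithin hs₁)
      (uniqueDiffOn_Icc (by linarith) t ht)
  have h₂' : ∀ t ∈ Icc 0 a, G.ConeAt γ₂ (Icc 0 a) t := fun t ht =>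
    (h₂ t (hs₂ ht)).mono_of_mem (Filter.mem_of_superset self_mem_nhdsWithin hs₂)
      (uniqueDiffOn_Icc ha0 t ht)
  have hv₁ : (0 : ℝ) ∈ Icc (-a) 0 := by simp [ha0.le]
  have hv₂ : (0 : ℝ) ∈ Icc 0 a := by simp [ha0.le]
  have hQ₁ := ((h₁' 0 hv₁).chart (uniqueDiffOn_Icc (by linarith) 0 hv₁) (p := p)
    (by rw [h₁p]; exact hpsrc)).2
  have hQ₂ := ((h₂' 0 hv₂).chart (uniqueDiffOn_Icc ha0 0 hv₂) (p := p)
    (by rw [h₂p]; exact hpsrc)).2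
  rw [h₁p] at hQ₁
  rw [h₂p] at hQ₂
  obtain ⟨δ, hδ, C, hC, hC₁, hC₂, hCδ⟩ := hcone.exists_smooth_corner hr (c₁ := φ ∘ γ₁)
    (c₂ := φ ∘ γ₂) ha0
    (contDiffOn_chart h₁' subset_rfl (uniqueDiffOn_Icc (by linarith)) hsrc₁)
    (contDiffOn_chart h₂' subset_rfl (uniqueDiffOn_Icc ha0) hsrc₂)
    (by simp [h₁p]) (by simp [h₂p]) hQ₁ hQ₂
  obtain ⟨hδ0, hδa⟩ := hδ
  set Γ : ℝ → N := fun t => if t ≤ -a then γ₁ t else if t < a then φ.symm (C t) else γ₂ t with hΓ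
  have hΓ₁ : ∀ t ≤ -δ, Γ t = γ₁ t := by
    intro t ht
    by_cases h1 : t ≤ -a
    · simp only [hΓ, if_pos h1]
    · simp only [hΓ, if_neg h1, if_pos (show t < a by linarith), hC₁ t ht, Function.comp]
      exact φ.left_inv (hsrc₁ t ⟨by linarith, by linarith⟩)
  have hΓ₂ : ∀ t ≥ δ, Γ t = γ₂ t := by
    intro t ht
    by_cases h1 : t < a
    · simp only [hΓ, if_neg (show ¬ t ≤ -a by linarith), if_pos h1, hC₂ t ht, Function.comp]
      exact φ.left_inv (hsrc₂ t ⟨by linarith, by linarith⟩)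
    · simp only [hΓ, if_neg (show ¬ t ≤ -a by linarith), if_neg h1]
  have hΓC : ∀ t ∈ Ioo (-a) a, Γ t = φ.symm (C t) := by
    intro t ht
    simp only [hΓ, if_neg ht.1.not_ge, if_pos ht.2]
  have huI : UniqueDiffOn ℝ (Icc (-1 : ℝ) 1) := uniqueDiffOn_Icc (by norm_num)
  have hfin : ∀ t ∈ Icc (-1 : ℝ) 1, G.ConeAt Γ (Icc (-1) 1) t := by
    intro t ht
    rcases lt_or_ge t (-δ) with h1 | h1
    · refine ((h₁ t ⟨ht.1, by linarith⟩).mono_of_mem ?_ (huI t ht)).congr ?_ (hΓ₁ t h1.le)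
      · filter_upwards [self_mem_nhdsWithin,
          mem_nhdsWithin_of_mem_nhds (gt_mem_nhds h1)] with t' ht' ht''
        exact ⟨ht'.1, by linarith [show t' < -δ from ht'']⟩
      · filter_upwards [mem_nhdsWithin_of_mem_nhds (gt_mem_nhds h1)] with t' ht'
        exact hΓ₁ t' (le_of_lt ht')
    · rcases le_or_gt t δ with h2 | h2
      · obtain ⟨hm, hQ⟩ := hCδ t ⟨h1, h2⟩
        have hta : t ∈ Ioo (-a) a := ⟨by linarith, by linarith⟩
        have hCt : ContDiffAt ℝ 1 C t := (hC t hta).contDiffAt (Ioo_mem_nhds hta.1 hta.2)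
        have h3 : G.ConeAt (φ.symm ∘ C) univ t := by
          refine coneAt_of_chart uniqueDiffWithinAt_univ hCt.contDiffWithinAt (hball hm) ?_ ?_
          · rw [nhdsWithin_univ]
            filter_upwards [hCt.continuousAt.eventually (Metric.isOpen_ball.mem_nhds hm)]
              with t' ht' using hball ht'
          · rwa [derivWithin_univ]
        refine (h3.mono_of_mem Filter.univ_mem (huI t ht)).congr ?_ (hΓC t hta)
        filter_upwards [mem_nhdsWithin_of_mem_nhds (Ioo_mem_nhds hta.1 hta.2)] with t' ht'
        exact hΓC t' ht'
      · refine ((h₂ t ⟨by linarith, ht.2⟩).mono_of_mem ?_ (huI t ht)).congr ?_ (hΓ₂ t h2.le)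
        · filter_upwards [self_mem_nhdsWithin,
            mem_nhdsWithin_of_mem_nhds (lt_mem_nhds h2)] with t' ht' ht''
          exact ⟨by linarith [show δ < t' from ht''], ht'.2⟩
        · filter_upwards [mem_nhdsWithin_of_mem_nhds (lt_mem_nhds h2)] with t' ht'
          exact hΓ₂ t' (le_of_lt ht')
  have := chron_of_coneAt (by norm_num) hfin
  rwa [hΓ₁ (-1) (by linarith), hΓ₂ 1 (by linarith)] at this

/-- Short straight segments in a chart with direction close to a vector of the cone are timelike. -/
theorem exists_chron_segment {p : N} {r K q : ℝ} {V : 𝔼}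
    (hcone : IsConeField (G.chartCone p) (fun ξ v => chartDifferential G.f p ξ v)
      (Metric.ball (extChartAt (𝓡∂ n) p p) r) K q V)
    (hball : Metric.ball (extChartAt (𝓡∂ n) p p) r ⊆ (extChartAt (𝓡∂ n) p).target) (hr : 0 < r)
    {v : 𝔼} (hv : 0 < G.chartCone p (extChartAt (𝓡∂ n) p p) v) :
    ∃ η > 0, ∀ ξ ∈ Metric.ball (extChartAt (𝓡∂ n) p p) η, ∀ s ∈ Ioo 0 η, ∀ w ∈ Metric.ball v η,
      G.Chron ((extChartAt (𝓡∂ n) p).symm ξ) ((extChartAt (𝓡∂ n) p).symm (ξ + s • w)) := by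
  set φ := extChartAt (𝓡∂ n) p with hφ
  set m := G.chartCone p (φ p) v with hm
  have hK := hcone.K_pos
  obtain ⟨η, hη, hη1, hηr, hηm⟩ : ∃ η > 0, η < 1 ∧ η * (‖v‖ + 2) < r ∧
      K * (η * (‖v‖ + 2)) * ‖v‖ + K * η < m := by
    have h1 : Filter.Tendsto (fun η : ℝ => K * (η * (‖v‖ + 2)) * ‖v‖ + K * η) (𝓝[>] 0) (𝓝 0) :=
      ((by fun_prop : Continuous fun η : ℝ => K * (η * (‖v‖ + 2)) * ‖v‖ + K * η).tendsto' 0 0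
        (by simp)).mono_left nhdsWithin_le_nhds
    have h2 : Filter.Tendsto (fun η : ℝ => η * (‖v‖ + 2)) (𝓝[>] 0) (𝓝 0) :=
      ((by fun_prop : Continuous fun η : ℝ => η * (‖v‖ + 2)).tendsto' 0 0
        (by simp)).mono_left nhdsWithin_le_nhds
    obtain ⟨η, h3, h4, h5, h6⟩ := ((h1.eventually_lt_const hv).and
      ((h2.eventually_lt_const hr).and (((gt_mem_nhds one_pos).filter_mono
        nhdsWithin_le_nhds).and self_mem_nhdsWithin))).exists
    exact ⟨η, h6, h5, h4, h3⟩
  refine ⟨η, hη, fun ξ hξ s hs w hw => ?_⟩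
  rw [mem_ball_iff_norm] at hξ hw
  have hw' : ‖w‖ ≤ ‖v‖ + 1 := by
    have := norm_add_le v (w - v)
    rw [add_sub_cancel] at this
    linarith
  have hpos : ∀ t ∈ Icc (0 : ℝ) 1, ‖ξ + (t * s) • w - φ p‖ ≤ η * (‖v‖ + 2) := by
    intro t ht
    rw [add_sub_right_comm]
    refine (norm_add_le _ _).trans ?_
    rw [norm_smul, norm_mul, Real.norm_of_nonneg ht.1, Real.norm_of_nonneg hs.1.le]
    have : t * s * ‖w‖ ≤ 1 * η * (‖v‖ + 1) := by
      have h1 := hs.1.le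
      have h2 := ht.2
      have h3 := hs.2.le
      gcongr
    linarith
  have hd : ∀ t : ℝ, HasDerivAt (fun t : ℝ => ξ + (t * s) • w) (s • w) t := by
    intro t
    have := (((hasDerivAt_id t).mul_const s).smul_const w).const_add ξ
    simpa using this
  have hmem : ∀ t ∈ Icc (0 : ℝ) 1, ξ + (t * s) • w ∈ Metric.ball (φ p) r := by
    intro t ht
    rw [mem_ball_iff_norm]
    exact (hpos t ht).trans_lt hηr
  have := chron_of_chart (G := G) (p := p) (c := fun t => ξ + (t * s) • w) (c' := fun _ => s • w)
    (by fun_prop) (fun t _ => (hd t).hasDerivWithinAt) (fun t ht => hball (hmem t ht)) (by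
      intro t ht
      rw [hcone.smul_eq _ (hmem t ht) s hs.1.le]
      refine mul_pos hs.1 ?_
      have h1 := hcone.lower_bound (Metric.mem_ball_self hr) (hmem t ht) w v
      have h2 : K * ‖ξ + (t * s) • w - φ p‖ * ‖v‖ ≤ K * (η * (‖v‖ + 2)) * ‖v‖ := by
        gcongr; exact hpos t ht
      have h3 : K * ‖w - v‖ ≤ K * η := by gcongr
      linarith)
  simp only [zero_mul, zero_smul, add_zero, one_mul] at this
  exact this

/-- `I⁺(u)` is open at interior points. -/
theorem Chron.eventually_right {u p : N} (h : G.Chron u p) (hp : G.f p < 1) :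
    ∀ᶠ x in 𝓝 p, G.Chron u x := by
  have hpI : G.f p ∈ Ioo (0 : ℝ) 1 := ⟨(G.f_mem u).1.trans_lt h.lt, hp⟩
  obtain ⟨r, hr, K, q, V, hcone, hball⟩ := exists_isConeField_ball h.regular_right hpI
  obtain ⟨γ, hγ, rfl, rfl⟩ := h
  have h1 := isFutureTimelikePath_iff.1 hγ
  set φ := extChartAt (𝓡∂ n) (γ 1) with hφ
  have h01 : (1 : ℝ) ∈ Icc (0 : ℝ) 1 := by simp
  have hu : UniqueDiffOn ℝ (Icc (0 : ℝ) 1) := uniqueDiffOn_Icc zero_lt_one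
  obtain ⟨hc, hQ⟩ := (h1 1 h01).chart (hu 1 h01) (mem_extChartAt_source (I := 𝓡∂ n) (γ 1))
  have hder := (hc.differentiableWithinAt one_ne_zero).hasDerivWithinAt
  set v := derivWithin (φ ∘ γ) (Icc 0 1) 1 with hv
  obtain ⟨η, hη, hseg⟩ := exists_chron_segment hcone hball hr hQ
  -- a point of the path, from which the segment to its end is almost parallel to the velocity
  obtain ⟨t, ht, hs, hsrc, hball', hdir⟩ : ∃ t ∈ Ioo (0 : ℝ) 1, 1 - t ∈ Ioo 0 η ∧
      γ t ∈ φ.source ∧ φ (γ t) ∈ Metric.ball (φ (γ 1)) η ∧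
      (1 - t)⁻¹ • (φ (γ 1) - φ (γ t)) ∈ Metric.ball v η := by
    have e1 : ∀ᶠ t in 𝓝[<] (1 : ℝ), t ∈ Ioo (0 : ℝ) 1 := Ioo_mem_nhdsLT zero_lt_one
    have e2 : ∀ᶠ t in 𝓝[<] (1 : ℝ), 1 - η < t :=
      nhdsWithin_le_nhds (lt_mem_nhds (by linarith))
    have hle : 𝓝[<] (1 : ℝ) ≤ 𝓝[Icc 0 1] 1 := by
      rw [← nhdsWithin_Ioo_eq_nhdsLT (zero_lt_one' ℝ)]
      exact nhdsWithin_mono _ Ioo_subset_Icc_self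
    have e3 : ∀ᶠ t in 𝓝[<] (1 : ℝ), γ t ∈ φ.source :=
      hle ((h1 1 h01).1.continuousWithinAt.eventually
        ((isOpen_extChartAt_source (γ 1)).mem_nhds (mem_extChartAt_source (γ 1))))
    have e4 : ∀ᶠ t in 𝓝[<] (1 : ℝ), φ (γ t) ∈ Metric.ball (φ (γ 1)) η :=
      hle (hc.continuousWithinAt.eventually (Metric.ball_mem_nhds _ hη))
    have e5 : ∀ᶠ t in 𝓝[<] (1 : ℝ), slope (φ ∘ γ) 1 t ∈ Metric.ball v η := by
      have := hasDerivWithinAt_iff_tendsto_slope.1 hder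
      refine (this.mono_left ?_).eventually (Metric.ball_mem_nhds _ hη)
      rw [← nhdsWithin_Ioo_eq_nhdsLT (zero_lt_one' ℝ)]
      exact nhdsWithin_mono _ fun t ht => ⟨⟨ht.1.le, ht.2.le⟩, ht.2.ne⟩
    obtain ⟨t, h2, h3, h4, h5, h6⟩ := (e1.and (e2.and (e3.and (e4.and e5)))).exists
    refine ⟨t, h2, ⟨by linarith [h2.2], by linarith⟩, h4, h5, ?_⟩
    rw [slope_def_module] at h6
    convert h6 using 1
    rw [← neg_sub 1 t, inv_neg, neg_smul, ← smul_neg, neg_sub]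
    rfl
  have hut : G.Chron (γ 0) (γ t) := chron_of_mem_Icc h1 le_rfl ht.1 ht.2.le
  have hev : ∀ᶠ x in 𝓝 (γ 1), x ∈ φ.source ∧ (1 - t)⁻¹ • (φ x - φ (γ t)) ∈ Metric.ball v η := by
    refine Filter.Eventually.and (extChartAt_source_mem_nhds (γ 1)) ?_
    have hcont : ContinuousAt (fun x => (1 - t)⁻¹ • (φ x - φ (γ t))) (γ 1) :=
      ((continuousAt_extChartAt (I := 𝓡∂ n) (γ 1)).sub continuousAt_const).const_smul (1 - t)⁻¹
    exact hcont.eventually (Metric.isOpen_ball.mem_nhds hdir)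
  filter_upwards [hev] with x hx
  refine hut.trans ?_
  have h2 := hseg (φ (γ t)) hball' (1 - t) hs _ hx.2
  rw [smul_inv_smul₀ hs.1.ne', add_sub_cancel] at h2
  rwa [φ.left_inv hsrc, φ.left_inv hx.1] at h2

/-- An interior regular point is a limit of points of its chronological future. -/
theorem mem_closure_future {p : N} (hp : p ∉ criticalSet (n := n) G.f)
    (hpI : G.f p ∈ Ioo (0 : ℝ) 1) : p ∈ closure {y | G.Chron p y} := by
  obtain ⟨r, hr, K, q, V, hcone, hball⟩ := exists_isConeField_ball hp hpI
  set φ := extChartAt (𝓡∂ n) p with hφ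
  obtain ⟨η, hη, hseg⟩ := exists_chron_segment hcone hball hr (v := V)
    (hcone.q_pos.trans_le (hcone.le_V _ (Metric.mem_ball_self hr)))
  have h1 : Filter.Tendsto (fun s : ℝ => φ.symm (φ p + s • V)) (𝓝[>] 0) (𝓝 p) := by
    have h2 : Filter.Tendsto (fun s : ℝ => φ p + s • V) (𝓝[>] 0) (𝓝 (φ p)) :=
      ((by fun_prop : Continuous fun s : ℝ => φ p + s • V).tendsto' 0 _ (by simp)).mono_left
        nhdsWithin_le_nhds
    have h3 := (continuousAt_extChartAt_symm (I := 𝓡∂ n) p).tendsto.comp h2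
    rwa [extChartAt_to_inv] at h3
  refine mem_closure_of_tendsto h1 ?_
  filter_upwards [Ioo_mem_nhdsGT hη] with s hs
  have := hseg (φ p) (Metric.mem_ball_self hη) s hs V (Metric.mem_ball_self hη)
  rwa [extChartAt_to_inv] at this

end MorseGeometry

/-! ### Limits of timelike paths -/

/-- Adding to a vector of the cone at `a` a multiple of `V` and a small error gives a vector of the
cone at a nearby point `b`. The multiple of `V` outweighs the error and the variation of the cones
from `a` to `b`, as `v` is bounded by `d` and `Δ` is small. -/
theorem IsConeField.pos_of_perturb {E : Type*} [NormedAddCommGroup E] [NormedSpace ℝ E]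
    {Q D : E → E → ℝ} {U : Set E} {K q : ℝ} {V : E} (h : IsConeField Q D U K q V)
    {a b v e : E} {ρ Δ d : ℝ} (ha : a ∈ U) (hb : b ∈ U) (hρ : 0 < ρ) (hΔ : 0 < Δ) (hΔ1 : Δ ≤ 1)
    (hΔq : K * K * ‖V‖ * Δ ≤ q / 4) (he : ‖e‖ * (K * K + K) < ρ * q / 2) (hv : 0 < Q a v)
    (hd : 0 < d) (hvd : ‖v‖ ≤ K * d) (hab : ‖b - a‖ ≤ ρ * ‖V‖ + ‖e‖) :
    0 < Q b (v + ((ρ * (d / Δ)) • V + (d / Δ) • e)) := by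
  have hK := h.K_pos
  have hq := h.q_pos
  set s := d / Δ with hs
  have hs0 : 0 < s := by positivity
  have hds : d = s * Δ := by rw [hs]; field_simp
  have h1 := h.add_le b hb v ((ρ * s) • V + s • e)
  have h2 := h.add_le b hb ((ρ * s) • V) (s • e)
  rw [h.smul_eq b hb _ (by positivity), h.smul_eq b hb _ hs0.le] at h2
  have h3 := (abs_le.1 (h.lip b hb a ha v)).1
  have h4 := (abs_le.1 (h.bdd b hb e)).1
  have h5 := h.le_V b hb
  have h6 : K * ‖b - a‖ * ‖v‖ ≤ K * (ρ * ‖V‖ + ‖e‖) * (K * d) := by gcongr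
  have h7 : K * (ρ * ‖V‖ + ‖e‖) * (K * d) = s * (ρ * (K * K * ‖V‖ * Δ) + K * K * ‖e‖ * Δ) := by
    rw [hds]; ring
  have h8 : K * K * ‖e‖ * Δ ≤ K * K * ‖e‖ := mul_le_of_le_one_right (by positivity) hΔ1
  have h9 : ρ * (K * K * ‖V‖ * Δ) ≤ ρ * (q / 4) := by gcongr
  have h10 : 0 < s * (ρ * q - ρ * (q / 4) - K * K * ‖e‖ - K * ‖e‖) := by
    apply mul_pos hs0
    have : 0 < ρ * q := by positivity
    linarith
  have h11 : ρ * s * q ≤ ρ * s * Q b V := by gcongr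
  have h12 : s * (-(K * ‖e‖)) ≤ s * Q b e := by gcongr
  have h13 : s * (ρ * (K * K * ‖V‖ * Δ) + K * K * ‖e‖ * Δ) ≤
      s * (ρ * (q / 4) + K * K * ‖e‖) := by gcongr
  linarith

namespace MorseGeometry
variable {n : ℕ} [NeZero n] {N : Type*} [TopologicalSpace N] [T2Space N] [CompactSpace N]
  [ChartedSpace (EuclideanHalfSpace n) N] [IsManifold (𝓡∂ n) ∞ N] {G : MorseGeometry n N}

local notation "𝔼" => EuclideanSpace ℝ (Fin n)

variable (G) in
/-- The closure of the chronology in the square of the cobordism. -/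
def chronClosure : Set (N × N) := closure {x | G.Chron x.1 x.2}

/-- Locally, chronological futures are stable under limits of timelike paths: if `u ≪ z` and `w` is
a limit of endpoints of timelike paths issuing from points close to `z`, then `u ≪ w`. The gain of
the pair `u ≪ z` is spread over the approximating path. -/
theorem exists_nhds_chron_of_mem_chronClosure {p : N} (hp : p ∉ criticalSet (n := n) G.f)
    (hpI : G.f p ∈ Ioo (0 : ℝ) 1) :
    ∃ W ∈ 𝓝 p, ∀ z ∈ W, ∀ w ∈ W, (z, w) ∈ G.chronClosure → ∀ u, G.Chron u z → G.Chron u w := by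
  obtain ⟨r, hr, K, q, V, hcone, hball⟩ := exists_isConeField_ball hp hpI
  set φ := extChartAt (𝓡∂ n) p with hφ
  have hK := hcone.K_pos
  have hq := hcone.q_pos
  have hφc : ContinuousAt φ p := continuousAt_extChartAt p
  have hW₀ : φ.source ∩ φ ⁻¹' Metric.ball (φ p) (r / 2) ∈ 𝓝 p :=
    Filter.inter_mem (extChartAt_source_mem_nhds p)
      (hφc.preimage_mem_nhds (Metric.ball_mem_nhds _ (half_pos hr)))
  obtain ⟨g, hg, hgp, hg0, hgle⟩ := exists_slow_function hp hW₀
  have hfc := G.smooth_f.continuous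
  obtain ⟨κ, hκ, hκg, hκ1, hκq⟩ : ∃ κ > 0, 2 * κ < g p / 2 ∧ 2 * κ ≤ 1 ∧
      K * K * ‖V‖ * (2 * κ) ≤ q / 4 := by
    have h1 : Filter.Tendsto (fun κ : ℝ => K * K * ‖V‖ * (2 * κ)) (𝓝[>] 0) (𝓝 0) :=
      ((by fun_prop : Continuous fun κ : ℝ => K * K * ‖V‖ * (2 * κ)).tendsto' 0 0
        (by simp)).mono_left nhdsWithin_le_nhds
    have h2 : ∀ᶠ κ : ℝ in 𝓝[>] 0, κ < min (g p / 4) (1 / 2) :=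
      nhdsWithin_le_nhds (gt_mem_nhds (by positivity))
    have h0 : ∀ᶠ κ : ℝ in 𝓝[>] 0, 0 < κ := self_mem_nhdsWithin
    obtain ⟨κ, h3, h4, h5⟩ := ((h1.eventually_lt_const (show (0 : ℝ) < q / 4 by positivity)).and
      (h2.and h0)).exists
    obtain ⟨h6, h7⟩ := lt_min_iff.1 h4
    exact ⟨κ, h5, by linarith, by linarith, h3.le⟩
  have hev : ∀ᶠ x in 𝓝 p, (x ∈ φ.source ∧ φ x ∈ Metric.ball (φ p) (r / 2)) ∧ g p / 2 < g x ∧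
      G.f x ∈ Ioo (G.f p - κ) (G.f p + κ) ∧ G.f x < 1 := by
    refine Filter.Eventually.and hW₀ (Filter.Eventually.and ?_ (Filter.Eventually.and ?_ ?_))
    · exact hg.continuousAt.eventually (lt_mem_nhds (half_lt_self hgp))
    · exact hfc.continuousAt.eventually (Ioo_mem_nhds (by linarith) (by linarith))
    · exact hfc.continuousAt.eventually (gt_mem_nhds hpI.2)
  obtain ⟨W, hWsub, hWo, hpW⟩ := mem_nhds_iff.1 hev
  refine ⟨W, hWo.mem_nhds hpW, fun z hz w hw hzw u huz => ?_⟩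
  obtain ⟨⟨hzsrc, hzball⟩, -, -, hz1⟩ := hWsub hz
  obtain ⟨⟨hwsrc, -⟩, -⟩ := hWsub hw
  have hφz : ContinuousAt φ z := continuousAt_extChartAt' hzsrc
  have hφw : ContinuousAt φ w := continuousAt_extChartAt' hwsrc
  obtain ⟨η, hη, hηu⟩ : ∃ η > 0, ∀ ξ ∈ Metric.ball (φ z) η, G.Chron u (φ.symm ξ) := by
    have h1 : ∀ᶠ ξ in 𝓝 (φ z), G.Chron u (φ.symm ξ) := by
      have h2 : ContinuousAt φ.symm (φ z) := continuousAt_extChartAt_symm' hzsrc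
      refine h2.eventually ?_
      rw [φ.left_inv hzsrc]
      exact huz.eventually_right hz1
    exact Metric.mem_nhds_iff.1 h1
  obtain ⟨ρ, hρ, hρη, hρr⟩ : ∃ ρ > 0, ρ * ‖V‖ < η / 2 ∧ ρ * ‖V‖ < r / 4 := by
    have h1 : 0 < min (η / 2) (r / 4) := by positivity
    refine ⟨min (η / 2) (r / 4) / (‖V‖ + 1), by positivity, ?_⟩
    rw [← lt_min_iff, div_mul_eq_mul_div, div_lt_iff₀ (by positivity)]
    nlinarith [norm_nonneg V]
  have hθ : 0 < min (r / 4) (ρ * q / 2 / (K * K + K)) := by positivity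
  -- a timelike path that joins points close to `z` and `w`
  obtain ⟨⟨z', w'⟩, ⟨⟨hz'W, hz'η⟩, hw'W, hw'⟩, hzw'⟩ := mem_closure_iff_nhds.1 hzw
    ((W ∩ φ ⁻¹' Metric.ball (φ z) (η / 2)) ×ˢ
      (W ∩ φ ⁻¹' Metric.ball (φ w) (min (r / 4) (ρ * q / 2 / (K * K + K)))))
    (prod_mem_nhds
      (Filter.inter_mem (hWo.mem_nhds hz)
        (hφz.preimage_mem_nhds (Metric.ball_mem_nhds _ (by positivity))))
      (Filter.inter_mem (hWo.mem_nhds hw) (hφw.preimage_mem_nhds (Metric.ball_mem_nhds _ hθ))))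
  simp only at hz'W hz'η hw'W hw'
  rw [mem_preimage, mem_ball_iff_norm] at hz'η
  rw [mem_preimage, mem_ball_iff_norm', lt_min_iff] at hw'
  set e := φ w - φ w' with he
  obtain ⟨her, heq⟩ := hw'
  have hlt : G.f z' < G.f w' := hzw'.lt
  obtain ⟨-, hz'g, hz'f, -⟩ := hWsub hz'W
  obtain ⟨-, -, hw'f, -⟩ := hWsub hw'W
  have hw'src : w' ∈ φ.source := (hWsub hw'W).1.1
  set Δ := G.f w' - G.f z' with hΔdef
  have hΔ : 0 < Δ := by linarith
  have hΔκ : Δ < 2 * κ := by linarith [hz'f.1, hw'f.2]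
  obtain ⟨γ, hγ, hγ0, hγ1⟩ := hzw'
  simp only at hγ0 hγ1
  have h1 := isFutureTimelikePath_iff.1 hγ
  have hu : UniqueDiffOn ℝ (Icc (0 : ℝ) 1) := uniqueDiffOn_Icc zero_lt_one
  have hmono := (strictMonoOn_comp_of_coneAt h1).monotoneOn
  have hF : ∀ t ∈ Icc (0 : ℝ) 1, G.f z' ≤ G.f (γ t) ∧ G.f (γ t) ≤ G.f w' := by
    intro t ht
    have h2 := hmono (by simp : (0 : ℝ) ∈ Icc (0 : ℝ) 1) ht ht.1
    have h3 := hmono ht (by simp : (1 : ℝ) ∈ Icc (0 : ℝ) 1) ht.2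
    simp only [Function.comp, hγ0, hγ1] at h2 h3
    exact ⟨h2, h3⟩
  -- the slow function `g` keeps the path in the chart: to leave, it would have to vary by
  -- `g p / 2`, but `f` varies by less than `2 * κ` along the path
  have htrap : ∀ t ∈ Icc (0 : ℝ) 1, γ t ∈ φ.source ∧ φ (γ t) ∈ Metric.ball (φ p) (r / 2) := by
    intro t ht
    by_contra hnot
    have h2 : g (γ t) = 0 := hg0 _ hnot
    rcases ht.1.eq_or_lt with h0 | h0
    · rw [← h0, hγ0] at h2
      linarith
    · have h3 := hgle _ _ (chron_of_mem_Icc h1 le_rfl h0 ht.2)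
      rw [h2, hγ0, zero_sub, abs_neg] at h3
      have := le_abs_self (g z')
      linarith [(hF t ht).2]
  have hc := contDiffOn_chart (p := p) h1 subset_rfl hu fun t ht => (htrap t ht).1
  set c := φ ∘ γ with hcdef
  set c' := derivWithin c (Icc 0 1) with hc'
  have hcd : ∀ t ∈ Icc (0 : ℝ) 1, HasDerivWithinAt c (c' t) (Icc 0 1) t := fun t ht =>
    (hc.differentiableOn one_ne_zero t ht).hasDerivWithinAt
  set d : ℝ → ℝ := fun t => chartDifferential G.f p (c t) (c' t) with hd
  have hFd : ∀ t ∈ Icc (0 : ℝ) 1, HasDerivWithinAt (fun t => G.f (γ t)) (d t) (Icc 0 1) t :=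
    fun t ht => (h1 t ht).hasDerivWithinAt_chart (hu t ht) (htrap t ht).1
  have hQ : ∀ t ∈ Icc (0 : ℝ) 1, 0 < G.chartCone p (c t) (c' t) := fun t ht =>
    ((h1 t ht).chart (hu t ht) (htrap t ht).1).2
  have hdpos : ∀ t ∈ Icc (0 : ℝ) 1, 0 < d t := fun t ht =>
    G.differential_pos_of_coneFn_pos (hQ t ht)
  have hFc : ContDiffOn ℝ 1 (fun t => G.f (γ t)) (Icc 0 1) :=
    contMDiffOn_iff_contDiffOn.1 ((G.smooth_f.of_le (by simp)).comp_contMDiffOn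
      (fun t ht => (h1 t ht).1))
  set τ : ℝ → ℝ := fun t => (G.f (γ t) - G.f z') / Δ with hτ
  have hτd : ∀ t ∈ Icc (0 : ℝ) 1, HasDerivWithinAt τ (d t / Δ) (Icc 0 1) t := fun t ht =>
    ((hFd t ht).sub_const _).div_const _
  have hτc : ContDiffOn ℝ 1 τ (Icc 0 1) := (hFc.sub contDiffOn_const).div_const _
  have hτI : ∀ t ∈ Icc (0 : ℝ) 1, τ t ∈ Icc (0 : ℝ) 1 := by
    intro t ht
    obtain ⟨h2, h3⟩ := hF t ht
    exact ⟨div_nonneg (by linarith) hΔ.le, (div_le_one hΔ).2 (by linarith)⟩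
  -- the perturbed path starts at `φ z' - ρ V`, which `u` precedes, and ends at `φ w`
  set b : ℝ → 𝔼 := fun t => c t + ((ρ * τ t - ρ) • V + τ t • e) with hb
  have hbc : ∀ t ∈ Icc (0 : ℝ) 1, ‖b t - c t‖ ≤ ρ * ‖V‖ + ‖e‖ := by
    intro t ht
    obtain ⟨h2, h3⟩ := hτI t ht
    simp only [hb, add_sub_cancel_left]
    refine (norm_add_le _ _).trans ?_
    rw [norm_smul, norm_smul, Real.norm_of_nonneg h2,
      Real.norm_of_nonpos (by nlinarith : ρ * τ t - ρ ≤ 0)]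
    have := norm_nonneg V
    have := norm_nonneg e
    gcongr
    · nlinarith
    · nlinarith
  have hbball : ∀ t ∈ Icc (0 : ℝ) 1, b t ∈ Metric.ball (φ p) r := by
    intro t ht
    have h2 := (htrap t ht).2
    have h3 := hbc t ht
    rw [mem_ball_iff_norm] at h2 ⊢
    have h4 := norm_add_le (b t - c t) (c t - φ p)
    rw [sub_add_sub_cancel] at h4
    have h5 : ‖c t - φ p‖ < r / 2 := h2
    linarith
  have hcball : ∀ t ∈ Icc (0 : ℝ) 1, c t ∈ Metric.ball (φ p) r := fun t ht =>
    Metric.ball_subset_ball (half_le_self hr.le) (htrap t ht).2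
  have hbd : ∀ t ∈ Icc (0 : ℝ) 1, HasDerivWithinAt b
      (c' t + ((ρ * (d t / Δ)) • V + (d t / Δ) • e)) (Icc 0 1) t := fun t ht =>
    (hcd t ht).add (((((hτd t ht).const_mul ρ).sub_const ρ).smul_const V).add
      ((hτd t ht).smul_const e))
  have hfin := chron_of_chart (G := G) (p := p) (c := b) (hc.add
    (((contDiffOn_const.mul hτc).sub contDiffOn_const).smul contDiffOn_const |>.add
      (hτc.smul contDiffOn_const))) hbd (fun t ht => hball (hbball t ht)) fun t ht =>
    hcone.pos_of_perturb (hcball t ht) (hbball t ht) hρ hΔ (by linarith)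
      (le_trans (by gcongr) hκq) ((lt_div_iff₀ (by positivity)).1 heq) (hQ t ht) (hdpos t ht)
      (hcone.norm_le _ (hcball t ht) _ (hQ t ht)) (hbc t ht)
  have hb0 : b 0 = φ z' + -(ρ • V) := by
    simp [hb, hτ, hγ0, hcdef]
  have hb1 : b 1 = φ w := by
    have : τ 1 = 1 := by simp [hτ, hγ1, ← hΔdef, hΔ.ne']
    simp [hb, this, hcdef, hγ1, he]
  rw [hb1, φ.left_inv hwsrc] at hfin
  refine (hηu _ ?_).trans hfin
  rw [hb0, mem_ball_iff_norm, add_sub_right_comm]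
  refine (norm_add_le _ _).trans_lt ?_
  rw [norm_neg, norm_smul, Real.norm_of_nonneg hρ.le]
  linarith

end MorseGeometry

namespace MorseGeometry
variable {n : ℕ} [NeZero n] {N : Type*} [TopologicalSpace N] [T2Space N] [CompactSpace N]
  [ChartedSpace (EuclideanHalfSpace n) N] [IsManifold (𝓡∂ n) ∞ N] {G : MorseGeometry n N}

theorem abs_sub_le_of_mem_chronClosure {g : N → ℝ} (hg : Continuous g)
    (hgle : ∀ x y, G.Chron x y → |g y - g x| ≤ G.f y - G.f x) {x y : N}
    (h : (x, y) ∈ G.chronClosure) : |g y - g x| ≤ G.f y - G.f x := by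
  have hf := G.smooth_f.continuous
  have h1 : IsClosed {q : N × N | |g q.2 - g q.1| ≤ G.f q.2 - G.f q.1} :=
    isClosed_le (by fun_prop) (by fun_prop)
  exact closure_minimal (fun q hq => hgle q.1 q.2 hq) h1 h

/-- Slow functions separate a regular point from every other point that is not later. -/
theorem eq_of_abs_sub_le {x y : N} (hx : x ∉ criticalSet (n := n) G.f)
    (h : ∀ g : N → ℝ, Continuous g → (∀ a b, G.Chron a b → |g b - g a| ≤ G.f b - G.f a) →
      |g y - g x| ≤ G.f y - G.f x) (hyx : G.f y ≤ G.f x) : x = y := by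
  by_contra hne
  obtain ⟨g, hg, hgx, hg0, hgle⟩ := exists_slow_function hx
    (isOpen_compl_singleton.mem_nhds (show x ∈ ({y} : Set N)ᶜ from hne))
  have h1 := h g hg hgle
  rw [hg0 y (by simp), zero_sub, abs_neg] at h1
  linarith [le_abs_self (g x)]

/-- A limit of timelike paths contains a chain of points that meets the levels of `f` at affine
parameter. -/
theorem exists_levels_of_mem_chronClosure {x y : N} (h : (x, y) ∈ G.chronClosure) :
    ∃ z : ℝ → N, z 0 = x ∧ z 1 = y ∧
      (∀ s ∈ Icc (0 : ℝ) 1, G.f (z s) = (1 - s) * G.f x + s * G.f y) ∧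
      ∀ s ∈ Icc (0 : ℝ) 1, ∀ s' ∈ Icc (0 : ℝ) 1, s < s' → (z s, z s') ∈ G.chronClosure := by
  obtain ⟨𝒰, h𝒰, hlim⟩ := mem_closure_iff_ultrafilter.1 h
  have h1 : ∀ q : N × N, ∃ Γ : ℝ → N, G.Chron q.1 q.2 → Γ 0 = q.1 ∧ Γ 1 = q.2 ∧
      (∀ s ∈ Icc (0 : ℝ) 1, G.f (Γ s) = (1 - s) * G.f q.1 + s * G.f q.2) ∧
      ∀ s ∈ Icc (0 : ℝ) 1, ∀ s' ∈ Icc (0 : ℝ) 1, s < s' → G.Chron (Γ s) (Γ s') := by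
    intro q
    by_cases hq : G.Chron q.1 q.2
    · obtain ⟨Γ, hΓ⟩ := hq.exists_levels
      exact ⟨Γ, fun _ => hΓ⟩
    · exact ⟨fun _ => q.1, fun h => absurd h hq⟩
  choose Γ hΓ using h1
  have h2 : ∀ s, ∃ z, Filter.Tendsto (fun q => Γ q s) 𝒰 (𝓝 z) := fun s =>
    ⟨_, (𝒰.map fun q => Γ q s).le_nhds_lim⟩
  choose z hz using h2
  have hf := G.smooth_f.continuous
  have hev : ∀ᶠ q : N × N in 𝒰, G.Chron q.1 q.2 := h𝒰
  have hx : Filter.Tendsto (fun q : N × N => q.1) 𝒰 (𝓝 x) :=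
    (continuous_fst.tendsto (x, y)).mono_left hlim
  have hy : Filter.Tendsto (fun q : N × N => q.2) 𝒰 (𝓝 y) :=
    (continuous_snd.tendsto (x, y)).mono_left hlim
  refine ⟨z, ?_, ?_, fun s hs => ?_, fun s hs s' hs' hss' => ?_⟩
  · exact tendsto_nhds_unique ((hz 0).congr' (hev.mono fun q hq => (hΓ q hq).1)) hx
  · exact tendsto_nhds_unique ((hz 1).congr' (hev.mono fun q hq => (hΓ q hq).2.1)) hy
  · have h3 : Filter.Tendsto (fun q => G.f (Γ q s)) 𝒰 (𝓝 (G.f (z s))) :=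
      (hf.tendsto _).comp (hz s)
    have h4 : Filter.Tendsto (fun q : N × N => (1 - s) * G.f q.1 + s * G.f q.2) 𝒰
        (𝓝 ((1 - s) * G.f x + s * G.f y)) :=
      (((hf.tendsto _).comp hx).const_mul _).add (((hf.tendsto _).comp hy).const_mul _)
    exact tendsto_nhds_unique (h3.congr' (hev.mono fun q hq => (hΓ q hq).2.2.1 s hs)) h4
  · exact mem_closure_of_tendsto ((hz s).prodMk_nhds (hz s'))
      (hev.mono fun q hq => (hΓ q hq).2.2.2 s hs s' hs' hss')

/-- Chronological futures are stable under limits of timelike paths that end at a regular point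
not above any critical level: such limits avoid the critical points, so that the local statement
applies along them. -/
theorem Chron.of_mem_chronClosure {u x y : N} (hux : G.Chron u x) (hxy : (x, y) ∈ G.chronClosure)
    (hy : y ∉ criticalSet (n := n) G.f) (hcrit : ∀ p ∈ criticalSet (n := n) G.f, G.f y ≤ G.f p)
    (hy1 : G.f y < 1) : G.Chron u y := by
  have hf := G.smooth_f.continuous
  have hle : G.f x ≤ G.f y := by
    have := abs_sub_le_of_mem_chronClosure (G := G) (g := fun _ => 0) continuous_const
      (fun a b hab => by simpa using hab.lt.le) hxy
    simpa using this
  rcases hle.eq_or_lt with heq | hlt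
  · have : x = y := eq_of_abs_sub_le hux.regular_right
      (fun g hg hgle => abs_sub_le_of_mem_chronClosure hg hgle hxy) heq.ge
    rwa [← this]
  obtain ⟨z, hz0, hz1, hzf, hzz⟩ := exists_levels_of_mem_chronClosure hxy
  have hreg : ∀ s ∈ Icc (0 : ℝ) 1, z s ∉ criticalSet (n := n) G.f := by
    intro s hs hmem
    rcases hs.2.eq_or_lt with rfl | h1
    · rw [hz1] at hmem
      exact hy hmem
    · have h2 := hcrit _ hmem
      rw [hzf s hs] at h2
      nlinarith
  have hI : ∀ s ∈ Icc (0 : ℝ) 1, G.f (z s) ∈ Ioo (0 : ℝ) 1 := by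
    intro s hs
    have h0 : 0 < G.f x := (G.f_mem u).1.trans_lt hux.lt
    rw [hzf s hs]
    constructor <;> nlinarith [hs.1, hs.2]
  have hcont : Continuous fun s : unitInterval => z s := by
    rw [continuous_iff_continuousAt]
    intro s W hW
    obtain ⟨g, hg, hgs, hg0, hgle⟩ := exists_slow_function (hreg s s.2) hW
    have h1 : ∀ s' : unitInterval, |g (z s') - g (z s)| ≤ |G.f (z s') - G.f (z s)| := by
      intro s'
      rcases lt_trichotomy s s' with h | h | h
      · exact (abs_sub_le_of_mem_chronClosure hg hgle (hzz s s.2 s' s'.2 h)).trans (le_abs_self _)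
      · simp [h]
      · rw [abs_sub_comm, abs_sub_comm (G.f _)]
        exact (abs_sub_le_of_mem_chronClosure hg hgle (hzz s' s'.2 s s.2 h)).trans (le_abs_self _)
    have h2 : Continuous fun s' : unitInterval => |G.f (z s') - G.f (z s)| := by
      have : (fun s' : unitInterval => |G.f (z s') - G.f (z s)|) = fun s' : unitInterval =>
          |(1 - (s' : ℝ)) * G.f x + s' * G.f y - G.f (z s)| := by
        funext s'
        rw [hzf s' s'.2]
      rw [this]
      fun_prop
    have h3 : ∀ᶠ s' : unitInterval in 𝓝 s, |G.f (z s') - G.f (z s)| < g (z s) :=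
      h2.continuousAt.eventually (gt_mem_nhds (by simpa using hgs))
    rw [Filter.mem_map]
    filter_upwards [h3] with s' hs'
    by_contra hnot
    have h4 := (h1 s').trans_lt hs'
    rw [hg0 _ hnot, zero_sub, abs_neg] at h4
    linarith [le_abs_self (g (z s))]
  have hW : ∀ s : unitInterval, ∃ W ∈ 𝓝 (z s), ∀ a ∈ W, ∀ b ∈ W, (a, b) ∈ G.chronClosure →
      ∀ u, G.Chron u a → G.Chron u b := fun s =>
    exists_nhds_chron_of_mem_chronClosure (hreg s s.2) (hI s s.2)
  choose W hWn hWc using hW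
  obtain ⟨t, ht0, htm, ⟨m, hm⟩, hsub⟩ := exists_monotone_Icc_subset_open_cover_unitInterval
    (c := fun s => (fun s' : unitInterval => z s') ⁻¹' interior (W s))
    (fun s => isOpen_interior.preimage hcont)
    (fun s _ => mem_iUnion.2 ⟨s, mem_interior_iff_mem_nhds.2 (hWn s)⟩)
  have hind : ∀ k, G.Chron u (z (t k)) := by
    intro k
    induction k with
    | zero => simpa [ht0, hz0] using hux
    | succ k ih =>
      obtain ⟨i, hi⟩ := hsub k
      have hk := htm (Nat.le_succ k)
      rcases hk.eq_or_lt with h | h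
      · rwa [← h]
      · exact hWc i _ (interior_subset (hi (left_mem_Icc.2 hk))) _
          (interior_subset (hi (right_mem_Icc.2 hk)))
          (hzz _ (t k).2 _ (t (k + 1)).2 h) u ih
  simpa [hm m le_rfl, hz1] using hind m

end MorseGeometry

/-! ### Reversal of time -/

section
variable {n : ℕ} [NeZero n] {N : Type*} [TopologicalSpace N]
  [ChartedSpace (EuclideanHalfSpace n) N]

theorem differential_one_sub (f : N → ℝ) (x : N) :
    differential (n := n) (fun y => 1 - f y) x = -differential (n := n) f x := by
  by_cases hf : MDifferentiableAt (𝓡∂ n) 𝓘(ℝ, ℝ) f x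
  · have h1 := (hasMFDerivAt_const (I := 𝓡∂ n) (I' := 𝓘(ℝ, ℝ)) (1 : ℝ) x).sub hf.hasMFDerivAt
    have h2 := h1.mfderiv
    refine Eq.trans h2 ?_
    exact zero_sub _
  · have h3 : differential (n := n) f x = 0 := mfderiv_zero_of_not_mdifferentiableAt hf
    rw [h3, neg_zero]
    refine mfderiv_zero_of_not_mdifferentiableAt fun h1 => hf ?_
    have h2 := (mdifferentiableAt_const (I := 𝓡∂ n) (I' := 𝓘(ℝ, ℝ)) (c := (1 : ℝ)) (x := x)).sub h1
    refine h2.congr_of_eventuallyEq (Filter.Eventually.of_forall fun y => ?_)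
    simp

theorem criticalSet_one_sub (f : N → ℝ) :
    criticalSet (n := n) (fun y => 1 - f y) = criticalSet (n := n) f := by
  ext x
  simp [criticalSet, differential_one_sub]

theorem coordHessian_one_sub (f : N → ℝ) (p : N) :
    coordHessian (n := n) (fun y => 1 - f y) p = -coordHessian (n := n) f p := by
  ext i j
  have h1 : ((fun y => 1 - f y) ∘ (extChartAt (𝓡∂ n) p).symm) =
      fun ξ => 1 - (f ∘ (extChartAt (𝓡∂ n) p).symm) ξ := rfl
  simp only [coordHessian, Matrix.of_apply, Matrix.neg_apply, h1]
  have h2 : fderiv ℝ (fun ξ => 1 - (f ∘ (extChartAt (𝓡∂ n) p).symm) ξ) =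
      fun ξ => -fderiv ℝ (f ∘ (extChartAt (𝓡∂ n) p).symm) ξ := by
    funext ξ
    rw [fderiv_const_sub]
  rw [h2, fderiv_fun_neg]
  rfl

variable [IsManifold (𝓡∂ n) ∞ N]

theorem gradientVec_one_sub (h : SmoothRiemannianMetric n N) (f : N → ℝ) (x : N) :
    gradientVec h (fun y => 1 - f y) x = -gradientVec h f x := by
  unfold gradientVec
  rw [differential_one_sub, ContinuousLinearMap.toLinearMap_neg, map_neg]
end

namespace MorseGeometry
variable {n : ℕ} [NeZero n] {N : Type*} [TopologicalSpace N] [T2Space N] [CompactSpace N]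
  [ChartedSpace (EuclideanHalfSpace n) N] [IsManifold (𝓡∂ n) ∞ N]

/-- The Morse geometry with the direction of time reversed: the Morse function is `1 - f`. -/
def reverse (G : MorseGeometry n N) : MorseGeometry n N where
  V₀ := G.V₁
  V₁ := G.V₀
  boundary_eq := by rw [G.boundary_eq, union_comm]
  boundary_disjoint := G.boundary_disjoint.symm
  h := G.h
  f := fun x => 1 - G.f x
  smooth_f := contMDiff_const.sub G.smooth_f
  f_mem := fun x => ⟨by linarith [(G.f_mem x).2], by linarith [(G.f_mem x).1]⟩
  f_preimage_zero := by
    rw [← G.f_preimage_one]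
    ext x
    simp only [mem_preimage, mem_singleton_iff]
    constructor <;> intro h <;> linarith
  f_preimage_one := by
    rw [← G.f_preimage_zero]
    ext x
    simp
  critical_interior := by
    rw [criticalSet_one_sub]
    exact G.critical_interior
  hessian_invertible := by
    intro p hp
    rw [criticalSet_one_sub] at hp
    rw [coordHessian_one_sub]
    exact (G.hessian_invertible p hp).neg
  ζ := G.ζ
  one_lt_ζ := G.one_lt_ζ

variable {G : MorseGeometry n N}

theorem reverse_f (x : N) : G.reverse.f x = 1 - G.f x := rfl

theorem criticalSet_reverse : criticalSet (n := n) G.reverse.f = criticalSet (n := n) G.f :=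
  criticalSet_one_sub G.f

theorem coneFn_reverse (x : N) (v : TangentSpace (𝓡∂ n) x) :
    G.reverse.coneFn x v = G.coneFn x (-v) := by
  have h1 : differential (n := n) G.reverse.f x = -differential (n := n) G.f x :=
    differential_one_sub G.f x
  have h2 : gradientVec G.reverse.h G.reverse.f x = -gradientVec G.h G.f x :=
    gradientVec_one_sub G.h G.f x
  have h3 : G.reverse.h = G.h := rfl
  have h4 : G.reverse.ζ = G.ζ := rfl
  unfold coneFn
  rw [h1, h2, h3, h4]
  simp

theorem Chron.reverse {x y : N} (h : G.Chron x y) : G.reverse.Chron y x := by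
  obtain ⟨γ, hγ, rfl, rfl⟩ := h
  have h1 := isFutureTimelikePath_iff.1 hγ
  refine ⟨fun t => γ (1 - t), isFutureTimelikePath_iff.2 fun t ht => ?_, by simp, by simp⟩
  have ht' : 1 - t ∈ Icc (0 : ℝ) 1 := ⟨by linarith [ht.2], by linarith [ht.1]⟩
  have hd : HasDerivWithinAt (fun t : ℝ => 1 - t) (-1) (Icc 0 1) t :=
    ((hasDerivAt_id t).const_sub 1).hasDerivWithinAt
  have hm : HasMFDerivWithinAt 𝓘(ℝ, ℝ) 𝓘(ℝ, ℝ) (fun t : ℝ => 1 - t) (Icc 0 1) t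
      (ContinuousLinearMap.toSpanSingleton ℝ (-1)) := hd.hasFDerivWithinAt.hasMFDerivWithinAt
  have hc : ContMDiff 𝓘(ℝ, ℝ) 𝓘(ℝ, ℝ) 1 (fun t : ℝ => 1 - t) := by
    rw [contMDiff_iff_contDiff]; fun_prop
  have hmaps : MapsTo (fun t : ℝ => 1 - t) (Icc 0 1) (Icc 0 1) := fun s hs =>
    ⟨by linarith [hs.2], by linarith [hs.1]⟩
  refine coneAt_of_hasMFDerivWithinAt (uniqueDiffOn_Icc zero_lt_one t ht)
    ((h1 _ ht').1.comp t hc.contMDiffAt.contMDiffWithinAt hmaps)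
    (HasMFDerivWithinAt.comp t (h1 _ ht').hasMFDerivWithinAt hm hmaps) ?_
  rw [coneFn_reverse]
  refine (h1 _ ht').2.trans_eq (coneFn_congr G rfl ?_)
  have h3 := (mfderivWithin 𝓘(ℝ, ℝ) (𝓡∂ n) γ (Icc 0 1) (1 - t)).map_neg (1 : ℝ)
  refine (neg_neg _).symm.trans (congrArg Neg.neg (h3.symm.trans ?_))
  exact congrArg (mfderivWithin 𝓘(ℝ, ℝ) (𝓡∂ n) γ (Icc 0 1) (1 - t))
    (show -(1 : ℝ) = (1 : ℝ) • (-1) by simp)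

theorem Chron.of_reverse {x y : N} (h : G.reverse.Chron x y) : G.Chron y x := by
  have h1 := h.reverse
  have h2 : G.reverse.reverse.f = G.f := by
    funext x
    simp [reverse_f]
  have h3 : G.reverse.reverse = G := by
    cases G
    simp only [MorseGeometry.reverse] at h2 ⊢
    congr
  rwa [h3] at h1

theorem chron_reverse {x y : N} : G.reverse.Chron x y ↔ G.Chron y x :=
  ⟨Chron.of_reverse, Chron.reverse⟩

theorem mem_chronClosure_reverse {x y : N} (h : (x, y) ∈ G.chronClosure) :
    (y, x) ∈ G.reverse.chronClosure :=
  map_mem_closure (f := Prod.swap) continuous_swap h fun _ hq => Chron.reverse hq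

theorem Chron.eventually_left {p w : N} (h : G.Chron p w) (hp : 0 < G.f p) :
    ∀ᶠ x in 𝓝 p, G.Chron x w :=
  (h.reverse.eventually_right (by rw [reverse_f]; linarith)).mono fun _ => Chron.of_reverse

theorem mem_closure_past {p : N} (hp : p ∉ criticalSet (n := n) G.f)
    (hpI : G.f p ∈ Ioo (0 : ℝ) 1) : p ∈ closure {y | G.Chron y p} := by
  have h := mem_closure_future (G := G.reverse) (by rwa [criticalSet_reverse])
    ⟨by rw [reverse_f]; linarith [hpI.2], by rw [reverse_f]; linarith [hpI.1]⟩
  simpa only [chron_reverse] using h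

/-- The past version of `Chron.of_mem_chronClosure`. -/
theorem Chron.of_mem_chronClosure_left {x y w : N} (hxy : (x, y) ∈ G.chronClosure)
    (hyw : G.Chron y w) (hx : x ∉ criticalSet (n := n) G.f)
    (hcrit : ∀ p ∈ criticalSet (n := n) G.f, G.f p ≤ G.f x) (hx0 : 0 < G.f x) : G.Chron x w := by
  refine (hyw.reverse.of_mem_chronClosure (mem_chronClosure_reverse hxy) ?_ ?_ ?_).of_reverse
  · rwa [criticalSet_reverse]
  · rw [criticalSet_reverse]
    intro p hp
    simp only [reverse_f]
    linarith [hcrit p hp]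
  · rw [reverse_f]
    linarith

end MorseGeometry

/-! ### Relations with a time function -/

theorem RelTransitive.preimage_swap {X : Type*} {R : Set (X × X)} (h : RelTransitive R) :
    RelTransitive (Prod.swap ⁻¹' R) :=
  fun x y z hxy hyz => h z y x hyz hxy

section Abstract
variable {X : Type*} [TopologicalSpace X] {I : Set (X × X)} {f : X → ℝ} {c : ℝ}

theorem KRel_subset_of_isClosed {R : Set (X × X)} (hI : I ⊆ R) (ht : RelTransitive R)
    (hc : IsClosed R) : KRel I ⊆ R :=
  (KRel_isLeast I).2 ⟨hI, ht, hc⟩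

theorem KRel_preimage_swap_subset (I : Set (X × X)) :
    KRel (Prod.swap ⁻¹' I) ⊆ Prod.swap ⁻¹' KRel I := by
  obtain ⟨⟨h1, h2, h3⟩, -⟩ := KRel_isLeast I
  exact (KRel_isLeast _).2 ⟨preimage_mono h1, h2.preimage_swap, h3.preimage continuous_swap⟩

theorem KRel_preimage_swap (I : Set (X × X)) :
    KRel (Prod.swap ⁻¹' I) = Prod.swap ⁻¹' KRel I := by
  refine (KRel_preimage_swap_subset I).antisymm fun q hq => ?_
  have h1 := KRel_preimage_swap_subset (Prod.swap ⁻¹' I)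
  rw [← preimage_comp, Prod.swap_swap_eq, preimage_id] at h1
  simpa using h1 hq

/-- The properties of the chronology of a Morse spacetime, with Morse function `f` and with `c` as
the only critical value, that determine its relation `K⁺`. All of them are invariant under reversal
of time. -/
structure IsMorseChronology (I : Set (X × X)) (f : X → ℝ) (c : ℝ) : Prop where
  continuous : Continuous f
  le_one : ∀ x, f x ≤ 1
  nonneg : ∀ x, 0 ≤ f x
  lt : ∀ x y, (x, y) ∈ I → f x < f y
  trans : RelTransitive I
  exists_mid : ∀ x y, (x, y) ∈ I → ∃ z, (x, z) ∈ I ∧ (z, y) ∈ I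
  exists_level : ∀ x y a, (x, y) ∈ I → f x < a → a < f y →
    ∃ z, f z = a ∧ (x, z) ∈ I ∧ (z, y) ∈ I
  eventually_right : ∀ u x, (u, x) ∈ I → f x < 1 → ∀ᶠ x' in 𝓝 x, (u, x') ∈ I
  eventually_left : ∀ x w, (x, w) ∈ I → 0 < f x → ∀ᶠ x' in 𝓝 x, (x', w) ∈ I
  mem_closure_future : ∀ x, f x ∈ Ioo (0 : ℝ) 1 → x ∈ closure {y | (x, y) ∈ I}
  mem_closure_past : ∀ x, f x ∈ Ioo (0 : ℝ) 1 → x ∈ closure {y | (y, x) ∈ I}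
  /-- Futures are stable under limits of timelike paths below the critical level. -/
  right_of_mem_closure : ∀ u x y, (u, x) ∈ I → (x, y) ∈ closure I → f y ≤ c → (u, y) ∈ I
  /-- Pasts are stable under limits of timelike paths above the critical level. -/
  left_of_mem_closure : ∀ x y w, (x, y) ∈ closure I → (y, w) ∈ I → c ≤ f x → (x, w) ∈ I
  /-- Points that are not separated by `f` are separated by a function that varies less than `f`
  along timelike paths. -/
  exists_separating : ∀ x y, f y ≤ f x → x ≠ y → ∃ g : X → ℝ, Continuous g ∧
    (∀ a b, (a, b) ∈ I → |g b - g a| ≤ f b - f a) ∧ f y - f x < |g y - g x|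
  isCompact_above : ∀ a, c < a → IsCompact {x | a ≤ f x}
  isCompact_below : ∀ a, a < c → IsCompact {x | f x ≤ a}
  crit_mem : c ∈ Ioo (0 : ℝ) 1

namespace IsMorseChronology

theorem swap (h : IsMorseChronology I f c) :
    IsMorseChronology (Prod.swap ⁻¹' I) (fun x => 1 - f x) (1 - c) where
  continuous := continuous_const.sub h.continuous
  le_one x := by linarith [h.nonneg x]
  nonneg x := by linarith [h.le_one x]
  lt x y hxy := by linarith [h.lt y x hxy]
  trans := h.trans.preimage_swap
  exists_mid x y hxy := by
    obtain ⟨z, h1, h2⟩ := h.exists_mid y x hxy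
    exact ⟨z, h2, h1⟩
  exists_level x y a hxy hxa hay := by
    obtain ⟨z, h0, h1, h2⟩ := h.exists_level y x (1 - a) hxy (by linarith) (by linarith)
    exact ⟨z, by linarith, h2, h1⟩
  eventually_right u x hux hx := h.eventually_left x u hux (by linarith)
  eventually_left x w hxw hx := h.eventually_right w x hxw (by linarith)
  mem_closure_future x hx := h.mem_closure_past x ⟨by linarith [hx.2], by linarith [hx.1]⟩
  mem_closure_past x hx := h.mem_closure_future x ⟨by linarith [hx.2], by linarith [hx.1]⟩
  right_of_mem_closure u x y hux hxy hy :=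
    h.left_of_mem_closure y x u
      (map_mem_closure (f := Prod.swap) continuous_swap hxy fun _ hq => hq) hux (by linarith)
  left_of_mem_closure x y w hxy hyw hx :=
    h.right_of_mem_closure w y x hyw
      (map_mem_closure (f := Prod.swap) continuous_swap hxy fun _ hq => hq) (by linarith)
  exists_separating x y hxy hne := by
    obtain ⟨g, hg, hgle, hlt⟩ := h.exists_separating y x (by linarith) hne.symm
    refine ⟨g, hg, fun a b hab => ?_, ?_⟩
    · rw [abs_sub_comm]
      linarith [hgle b a hab]
    · rw [abs_sub_comm]
      linarith
  isCompact_above a ha := by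
    have h1 : {x | a ≤ 1 - f x} = {x | f x ≤ 1 - a} := by
      ext x
      simp only [mem_ofPred_eq]
      constructor <;> intro <;> linarith
    rw [h1]
    exact h.isCompact_below _ (by linarith)
  isCompact_below a ha := by
    have h1 : {x | 1 - f x ≤ a} = {x | 1 - a ≤ f x} := by
      ext x
      simp only [mem_ofPred_eq]
      constructor <;> intro <;> linarith
    rw [h1]
    exact h.isCompact_above _ (by linarith)
  crit_mem := ⟨by linarith [h.crit_mem.2], by linarith [h.crit_mem.1]⟩

/-- If `(x, y) ∈ K⁺`, the past of `x` precedes the future of `y`: this relation is closed and, by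
the stability of futures below the critical level and of pasts above it, transitive. -/
theorem KRel_subset (h : IsMorseChronology I f c) {x y : X} (hxy : (x, y) ∈ KRel I) :
    f x ≤ f y ∧ ∀ u w, (u, x) ∈ I → (y, w) ∈ I → (u, w) ∈ I := by
  refine KRel_subset_of_isClosed (R := {q : X × X | f q.1 ≤ f q.2 ∧
    ∀ u w, (u, q.1) ∈ I → (q.2, w) ∈ I → (u, w) ∈ I}) ?_ ?_ ?_ hxy
  · intro q hq
    exact ⟨(h.lt _ _ hq).le, fun u w hu hw => h.trans _ _ _ (h.trans _ _ _ hu hq) hw⟩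
  · rintro x y z ⟨hxy, h1⟩ ⟨hyz, h2⟩
    refine ⟨hxy.trans hyz, fun u w hux hzw => ?_⟩
    simp only at hxy hyz h1 h2 hux hzw
    have hy : f y ∈ Ioo (0 : ℝ) 1 :=
      ⟨((h.nonneg u).trans_lt (h.lt _ _ hux)).trans_le hxy,
        hyz.trans_lt ((h.lt _ _ hzw).trans_le (h.le_one w))⟩
    rcases le_total (f y) c with hc | hc
    · obtain ⟨u₁, huu, hux₁⟩ := h.exists_mid _ _ hux
      refine h2 u w (h.right_of_mem_closure u u₁ y huu ?_ hc) hzw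
      exact map_mem_closure (Continuous.prodMk_right u₁) (h.mem_closure_future y hy)
        fun v hv => h1 u₁ v hux₁ hv
    · obtain ⟨w₁, hzw₁, hww⟩ := h.exists_mid _ _ hzw
      refine h1 u w hux (h.left_of_mem_closure y w₁ w ?_ hww hc)
      exact map_mem_closure (f := fun v => (v, w₁)) (by fun_prop) (h.mem_closure_past y hy)
        fun v hv => h2 v w₁ hv hzw₁
  · refine isClosed_of_closure_subset ?_
    rintro ⟨x, y⟩ hq
    have hf := h.continuous
    have hle : f x ≤ f y := closure_minimal
      (t := {q : X × X | f q.1 ≤ f q.2}) (fun q hq => hq.1)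
      (isClosed_le (by fun_prop) (by fun_prop)) hq
    refine ⟨hle, fun u w hux hyw => ?_⟩
    simp only at hux hyw
    have h1 := h.eventually_right u x hux
      (hle.trans_lt ((h.lt _ _ hyw).trans_le (h.le_one w)))
    have h2 := h.eventually_left y w hyw (((h.nonneg u).trans_lt (h.lt _ _ hux)).trans_le hle)
    obtain ⟨⟨x', y'⟩, ⟨h3, h4⟩, -, h5⟩ := mem_closure_iff_nhds.1 hq _ (prod_mem_nhds h1 h2)
    exact h5 u w h3 h4

/-- `K⁺` is antisymmetric, in the strong form that related points on the same level are equal. -/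
theorem eq_of_mem_KRel (h : IsMorseChronology I f c) {x y : X} (hxy : (x, y) ∈ KRel I)
    (hyx : f y ≤ f x) : x = y := by
  by_contra hne
  obtain ⟨g, hg, hgle, hlt⟩ := h.exists_separating x y hyx hne
  have hf := h.continuous
  refine hlt.not_ge (KRel_subset_of_isClosed (R := {q : X × X | |g q.2 - g q.1| ≤ f q.2 - f q.1})
    (fun q hq => hgle _ _ hq) (fun x y z hxy hyz => ?_) ?_ hxy)
  · have := abs_sub_le (g z) (g y) (g x)
    simp only [mem_ofPred_eq] at *
    linarith
  · exact isClosed_le (by fun_prop) (by fun_prop)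

/-- Between `K⁺`-related points there is a point on every level above the critical one. The relation
that says this is closed, because the level is compact. -/
theorem exists_level_of_mem_KRel (h : IsMorseChronology I f c) {x y : X} (hxy : (x, y) ∈ KRel I)
    {a : ℝ} (hac : c < a) (hxa : f x < a) (hay : a < f y) :
    ∃ z, f z = a ∧ (x, z) ∈ KRel I ∧ (z, y) ∈ KRel I := by
  obtain ⟨⟨hI, htrans, hcl⟩, -⟩ := KRel_isLeast I
  have hf := h.continuous
  have hL : IsCompact {x | f x = a} :=
    (h.isCompact_above a hac).of_isClosed_subset (isClosed_eq hf continuous_const)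
      fun x hx => (mem_ofPred_eq.mp hx).ge
  have h1 := KRel_subset_of_isClosed (R := KRel I ∩ ({q : X × X | a ≤ f q.1} ∪
      ({q : X × X | f q.2 ≤ a} ∪
        {q : X × X | ∃ z, f z = a ∧ (q.1, z) ∈ KRel I ∧ (z, q.2) ∈ KRel I}))) ?_ ?_ ?_ hxy
  · rcases h1.2 with h2 | h2 | h2
    · exact absurd h2 hxa.not_ge
    · exact absurd h2 hay.not_ge
    · exact h2
  · rintro ⟨x, y⟩ hq
    refine ⟨hI hq, ?_⟩
    by_cases h2 : a ≤ f x
    · exact Or.inl h2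
    by_cases h3 : f y ≤ a
    · exact Or.inr (Or.inl h3)
    obtain ⟨z, h4, h5, h6⟩ := h.exists_level x y a hq (not_le.1 h2) (not_le.1 h3)
    exact Or.inr (Or.inr ⟨z, h4, hI h5, hI h6⟩)
  · rintro x y z ⟨hxy, h2⟩ ⟨hyz, h3⟩
    refine ⟨htrans _ _ _ hxy hyz, ?_⟩
    rcases h2 with h2 | h2 | ⟨v, h4, h5, h6⟩
    · exact Or.inl h2
    · rcases h3 with h3 | h3 | ⟨v, h4, h5, h6⟩
      · exact Or.inr (Or.inr ⟨y, le_antisymm h2 h3, hxy, hyz⟩)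
      · exact Or.inr (Or.inl h3)
      · exact Or.inr (Or.inr ⟨v, h4, htrans _ _ _ hxy h5, h6⟩)
    · exact Or.inr (Or.inr ⟨v, h4, h5, htrans _ _ _ h6 hyz⟩)
  · refine hcl.inter ((isClosed_le (by fun_prop) (by fun_prop)).union
      ((isClosed_le (by fun_prop) (by fun_prop)).union ?_))
    have := isCompact_iff_compactSpace.1 hL
    -- the projection along the compact level is a closed map
    have h2 : IsClosed {r : {x | f x = a} × (X × X) |
        (r.2.1, (r.1 : X)) ∈ KRel I ∧ ((r.1 : X), r.2.2) ∈ KRel I} :=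
      (hcl.preimage (by fun_prop)).inter (hcl.preimage (by fun_prop))
    convert isClosedMap_snd_of_compactSpace _ h2 using 1
    ext q
    constructor
    · rintro ⟨z, h3, h4, h5⟩
      exact ⟨(⟨z, h3⟩, q), ⟨h4, h5⟩, rfl⟩
    · rintro ⟨⟨z, q⟩, ⟨h4, h5⟩, rfl⟩
      exact ⟨z, z.2, h4, h5⟩

/-- The final boundary, where the chronological future is empty, is in the closure of the part of a
`K⁺`-future below it. -/
theorem mem_closure_KRel_inter (h : IsMorseChronology I f c) {x y : X} (hxy : (x, y) ∈ KRel I)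
    (hx : f x < 1) (hy : f y = 1) : y ∈ closure {z | (x, z) ∈ KRel I ∧ f z < 1} := by
  obtain ⟨⟨-, -, hcl⟩, -⟩ := KRel_isLeast I
  have hf := h.continuous
  set b := max (f x) c with hb
  have hb1 : b < 1 := max_lt hx h.crit_mem.2
  have h1 : ∀ a, ∃ z, a ∈ Ioo b 1 → f z = a ∧ (x, z) ∈ KRel I ∧ (z, y) ∈ KRel I := by
    intro a
    by_cases ha : a ∈ Ioo b 1
    · obtain ⟨h2, h3⟩ := max_lt_iff.1 ha.1
      obtain ⟨z, hz⟩ := h.exists_level_of_mem_KRel hxy h3 h2 (ha.2.trans_eq hy.symm)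
      exact ⟨z, fun _ => hz⟩
    · exact ⟨x, fun h => absurd h ha⟩
  choose z hz using h1
  -- a limit point of `z a` as `a` tends to `1` is on the level of `y`, hence equal to `y`
  obtain ⟨m, hbm, hm1⟩ := exists_between hb1
  let 𝒰 : Ultrafilter ℝ := Ultrafilter.of (𝓝[<] 1)
  have h𝒰 : (𝒰 : Filter ℝ) ≤ 𝓝[<] 1 := Ultrafilter.of_le _
  have hev : ∀ᶠ a in 𝒰, a ∈ Ioo m 1 := h𝒰 (Ioo_mem_nhdsLT hm1)
  have hev' : ∀ᶠ a in 𝒰, f (z a) = a ∧ (x, z a) ∈ KRel I ∧ (z a, y) ∈ KRel I :=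
    hev.mono fun a ha => hz a ⟨hbm.trans ha.1, ha.2⟩
  obtain ⟨p, -, hp⟩ := (h.isCompact_above m ((le_max_right _ _).trans_lt hbm)).ultrafilter_le_nhds
    (𝒰.map z) (by
      rw [Filter.le_principal_iff, Ultrafilter.coe_map, Filter.mem_map]
      filter_upwards [hev, hev'] with a ha ha'
      exact ha.1.le.trans_eq ha'.1.symm)
  have hlim : Filter.Tendsto z 𝒰 (𝓝 p) := hp
  have hfp : f p = 1 := by
    have h2 : Filter.Tendsto (fun a => f (z a)) 𝒰 (𝓝 (f p)) := (hf.tendsto p).comp hlim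
    have h3 : Filter.Tendsto (fun a : ℝ => a) 𝒰 (𝓝 1) := h𝒰.trans nhdsWithin_le_nhds
    exact tendsto_nhds_unique (h2.congr' (hev'.mono fun a ha => ha.1)) h3
  have hpy : (p, y) ∈ KRel I := hcl.mem_of_tendsto (hlim.prodMk_nhds tendsto_const_nhds)
    (hev'.mono fun a ha => ha.2.2)
  rw [← h.eq_of_mem_KRel hpy (hy.trans hfp.symm).le]
  refine mem_closure_of_tendsto hlim ?_
  filter_upwards [hev, hev'] with a ha ha'
  exact ⟨ha'.2.1, ha'.1.trans_lt ha.2⟩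

theorem relFuture_KRel_eq (h : IsMorseChronology I f c) {x : X} (hx : f x ∈ Ioo (0 : ℝ) 1) :
    relFuture (KRel I) x = closure (commonFuture I (relPast I x)) := by
  obtain ⟨⟨hI, -, hcl⟩, -⟩ := KRel_isLeast I
  apply subset_antisymm
  · have h1 : {y | (x, y) ∈ KRel I ∧ f y < 1} ⊆ closure (commonFuture I (relPast I x)) := by
      rintro y ⟨hxy, hy1⟩
      obtain ⟨hle, hR⟩ := h.KRel_subset hxy
      have h2 := (isOpen_lt h.continuous continuous_const).inter_closure
        ⟨hy1, h.mem_closure_future y ⟨hx.1.trans_le hle, hy1⟩⟩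
      refine closure_mono (interior_maximal ?_ ?_) h2
      · rintro w ⟨-, hw⟩ u hu
        exact hR u w hu hw
      · rw [isOpen_iff_mem_nhds]
        rintro w ⟨hw1, hw⟩
        exact Filter.inter_mem ((isOpen_lt h.continuous continuous_const).mem_nhds hw1)
          (h.eventually_right y w hw hw1)
    intro y hxy
    rcases (h.le_one y).lt_or_eq with hy | hy
    · exact h1 ⟨hxy, hy⟩
    · exact closure_minimal h1 isClosed_closure (h.mem_closure_KRel_inter hxy hx.2 hy)
  · refine closure_minimal (fun y hy => ?_) (hcl.preimage (Continuous.prodMk_right x))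
    have h1 := interior_subset hy
    exact hcl.closure_subset (map_mem_closure (f := fun u => (u, y)) (by fun_prop)
      (h.mem_closure_past x hx) fun u hu => hI (h1 u hu))

theorem relPast_KRel_eq (h : IsMorseChronology I f c) {x : X} (hx : f x ∈ Ioo (0 : ℝ) 1) :
    relPast (KRel I) x = closure (commonPast I (relFuture I x)) := by
  have h1 := h.swap.relFuture_KRel_eq (x := x) ⟨by linarith [hx.2], by linarith [hx.1]⟩
  rw [KRel_preimage_swap] at h1
  exact h1

end IsMorseChronology
end Abstract

/-! ### The chronology of a Morse spacetime -/

namespace MorseGeometry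
variable {n : ℕ} [NeZero n] {N : Type*} [TopologicalSpace N] [T2Space N] [CompactSpace N]
  [ChartedSpace (EuclideanHalfSpace n) N] [IsManifold (𝓡∂ n) ∞ N] {G : MorseGeometry n N}

theorem isMorseChronology {c : ℝ} (hc : G.f '' criticalSet (n := n) G.f = {c}) :
    IsMorseChronology G.chronology (fun x => G.f x) c := by
  have hcrit : ∀ p ∈ criticalSet (n := n) G.f, G.f p = c := fun p hp =>
    (hc.subset (mem_image_of_mem _ hp) : G.f p ∈ ({c} : Set ℝ))
  have hcI : c ∈ Ioo (0 : ℝ) 1 := by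
    obtain ⟨p, hp, rfl⟩ : c ∈ G.f '' criticalSet (n := n) G.f := by rw [hc]; rfl
    refine mem_Ioo_of_notMem_boundary ?_
    rw [← mem_compl_iff, ModelWithCorners.compl_boundary]
    exact G.critical_interior hp
  have hf := G.smooth_f.continuous
  have hfs : Continuous fun x : G.Spacetime => G.f x := hf.comp continuous_subtype_val
  have hchron : ∀ x y : G.Spacetime, (x, y) ∈ G.chronology ↔ G.Chron x y := fun _ _ => Iff.rfl
  have hcl : ∀ x y : G.Spacetime, (x, y) ∈ closure G.chronology →
      ((x : N), (y : N)) ∈ G.chronClosure := fun x y hxy =>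
    map_mem_closure (f := fun q : G.Spacetime × G.Spacetime => ((q.1 : N), (q.2 : N)))
      (by fun_prop) hxy fun _ hq => hq
  exact {
    continuous := hfs
    le_one := fun x => (G.f_mem x).2
    nonneg := fun x => (G.f_mem x).1
    lt := fun x y hxy => Chron.lt hxy
    trans := fun x y z hxy hyz => Chron.trans hxy hyz
    exists_mid := fun x y hxy => by
      obtain ⟨z, h1, h2⟩ := Chron.exists_mid hxy
      exact ⟨⟨z, h1.regular_right⟩, h1, h2⟩
    exists_level := fun x y a hxy hxa hay => by
      obtain ⟨Γ, h0, h1, hfΓ, hΓ⟩ := Chron.exists_levels hxy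
      simp only at h0 h1 hfΓ
      have hd : 0 < G.f y - G.f x := by linarith
      have hs : (a - G.f x) / (G.f y - G.f x) ∈ Ioo (0 : ℝ) 1 :=
        ⟨div_pos (by linarith) hd, (div_lt_one hd).2 (by linarith)⟩
      set s := (a - G.f x) / (G.f y - G.f x) with hsdef
      have h2 := hΓ 0 (by simp) s ⟨hs.1.le, hs.2.le⟩ hs.1
      have h3 := hΓ s ⟨hs.1.le, hs.2.le⟩ 1 (by simp) hs.2
      rw [h0] at h2
      rw [h1] at h3
      refine ⟨⟨Γ s, h2.regular_right⟩, ?_, h2, h3⟩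
      simp only [hfΓ s ⟨hs.1.le, hs.2.le⟩]
      have : s * (G.f y - G.f x) = a - G.f x := div_mul_cancel₀ _ hd.ne'
      linarith
    eventually_right := fun u x hux hx =>
      continuous_subtype_val.continuousAt.eventually (Chron.eventually_right hux hx)
    eventually_left := fun x w hxw hx =>
      continuous_subtype_val.continuousAt.eventually (Chron.eventually_left hxw hx)
    mem_closure_future := fun x hx => by
      rw [closure_subtype]
      refine closure_mono (fun y hy => ?_) (MorseGeometry.mem_closure_future x.2 hx)
      exact ⟨⟨y, hy.regular_right⟩, hy, rfl⟩
    mem_closure_past := fun x hx => by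
      rw [closure_subtype]
      refine closure_mono (fun y hy => ?_) (MorseGeometry.mem_closure_past x.2 hx)
      exact ⟨⟨y, hy.regular_left⟩, hy, rfl⟩
    right_of_mem_closure := fun u x y hux hxy hy =>
      Chron.of_mem_chronClosure hux (hcl x y hxy) y.2 (fun p hp => hy.trans_eq (hcrit p hp).symm)
        (hy.trans_lt hcI.2)
    left_of_mem_closure := fun x y w hxy hyw hx =>
      Chron.of_mem_chronClosure_left (hcl x y hxy) hyw x.2 (fun p hp => (hcrit p hp).trans_le hx)
        (hcI.1.trans_le hx)
    exists_separating := fun x y hyx hne => by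
      by_contra! hcon
      refine hne (Subtype.ext (eq_of_abs_sub_le x.2 (fun g hg hgle => ?_) hyx))
      exact hcon (fun z => g z) (hg.comp continuous_subtype_val) fun a b hab => hgle a b hab
    isCompact_above := fun a ha => by
      rw [Subtype.isCompact_iff]
      convert (isClosed_le continuous_const hf : IsClosed {x : N | a ≤ G.f x}).isCompact using 1
      ext x
      constructor
      · rintro ⟨z, hz, rfl⟩
        exact hz
      · intro hx
        refine ⟨⟨x, fun hmem => ?_⟩, hx, rfl⟩
        rw [mem_ofPred_eq, hcrit x hmem] at hx
        exact hx.not_gt ha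
    isCompact_below := fun a ha => by
      rw [Subtype.isCompact_iff]
      convert (isClosed_le hf continuous_const : IsClosed {x : N | G.f x ≤ a}).isCompact using 1
      ext x
      constructor
      · rintro ⟨z, hz, rfl⟩
        exact hz
      · intro hx
        refine ⟨⟨x, fun hmem => ?_⟩, hx, rfl⟩
        rw [mem_ofPred_eq, hcrit x hmem] at hx
        exact hx.not_gt ha
    crit_mem := hcI }

end MorseGeometry

theorem lemma3p1 {n : ℕ} [NeZero n] {N : Type*} [TopologicalSpace N] [T2Space N]
    [CompactSpace N] [ChartedSpace (EuclideanHalfSpace n) N] [IsManifold (𝓡∂ n) ∞ N]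
    (G : MorseGeometry n N)
    (hcrit : ∃ c : ℝ, G.f '' criticalSet (n := n) G.f = {c})
    (x : G.Spacetime) (hx : (x : N) ∉ (𝓡∂ n).boundary N) :
    G.KPlus x = closure (commonFuture G.chronology (G.IMinus x)) ∧
      G.KMinus x = closure (commonPast G.chronology (G.IPlus x)) := by
  obtain ⟨c, hc⟩ := hcrit
  have h := MorseGeometry.isMorseChronology hc
  have hxI := MorseGeometry.mem_Ioo_of_notMem_boundary (G := G) hx
  exact ⟨h.relFuture_KRel_eq hxI, h.relPast_KRel_eq hxI⟩

end
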